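/- Let $n,p\ge 1$ and let $X\in\mathbb{R}^{n\times p}$ have independent entries $X_{ai}\sim N(M_{ai},1)$ with unknown mean $M\in\mathbb{R}^{n\times p}$; write $p(X\mid M)$ for its density and $E_M$ for its expectation. For an estimator $\hat M$ (a measurable map $\mathbb{R}^{n\times p}\to\mathbb{R}^{n\times p}$) the matrix quadratic loss is $L(M,\hat M)=(\hat M-M)^\top(\hat M-M)$ and its risk is $R(M,\hat M)=E_M[L(M,\hat M(X))]$. The estimator $\hat M$ is called minimax if $\sup_M c^\top R(M,\hat M)c=\inf_{\hat M'}\sup_M c^\top R(M,\hat M')c$ for every $c\in\mathbb{R}^p$, where $c^\top R(M,\hat M)c=E_M\|(\hat M(X)-M)c\|^2\in[0,\infty]$ and the infimum is over all estimators. A function $f:\mathbb{R}^{n\times p}\to\mathbb{R}\cup\{\infty\}$ is called matrix superharmonic if it is lower semicontinuous, $f\not\equiv\infty$, and for all $X\in\mathbb{R}^{n\times p}$ and $\rho\in\mathbb{R}^p$ the average of $f(X+e\rho^\top)$ over the unit sphere $\{e\in\mathbb{R}^n:\|e\|=1\}$, with respect to normalized surface measure, is at most $f(X)$. Write $(\widetilde\nabla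 f)_{ai}=\partial f/\partial X_{ai}$ and $(\widetilde\Delta f)_{ij}=\sum_{a=1}^n\partial^2 f/\partial X_{ai}\partial X_{aj}$, and let $\preceq$ be the Löwner order. Let $\pi:\mathbb{R}^{n\times p}\to[0,\infty]$ be a measurable, possibly improper, prior density that is not almost everywhere zero, and let $m_\pi(X)=\int p(X\mid M)\,\pi(M)\,dM\in[0,\infty]$. Theorem. If $\sqrt{m_\pi}$ is matrix superharmonic, then $0<m_\pi(X)<\infty$ for every $X$, $\sqrt{m_\pi}$ is $C^2$, and the estimator $\hat M^\pi(X)=X+\widetilde\nabla\log m_\pi(X)$ is the unique generalized Bayes estimator with respect to $\pi$ (that is, for every $X$ the value $\hat M^\pi(X)$ is the unique $D$ that minimizes, in the Löwner order, the posterior expectation of $(D-M)^\top(D-M)$ given $X$), and $\hat M^\pi$ is minimax under the matrix quadratic loss. Moreover, for every $M$ the entries of $L(M,\hat M^\pi(X))$ and of $\widetilde\Delta\sqrt{m_\pi(X)}/\sqrt{m_\pi(X)}$ are integrable, and $$R(M,\hat M^\pi)=nI_p+4\,E_M\!\left[\frac{\widetilde\Delta\sqrt{m_\pi(X)}}{\sqrt{m_\pi(X)}}\right]\preceq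 nI_p .$$ -/

import Mathlib

open MeasureTheory ProbabilityTheory
open scoped ENNReal Matrix

noncomputable section

/-- Real `n × p` matrices, as functions of the two indices. The topology is the Euclidean one,
`volume` is the product Lebesgue measure `dM = ∏ dM_{ai}`. -/
abbrev RealMat (n p : ℕ) : Type := Fin n → Fin p → ℝ

/-- The law `N_{n,p}(M, I_n, I_p)`: independent entries `X_{ai} ∼ N(M_{ai}, 1)`. -/
def matrixNormal {n p : ℕ} (M : RealMat n p) : Measure (RealMat n p) :=
  Measure.pi fun a => Measure.pi fun i => gaussianReal (M a i) 1

/-- The Lebesgue density `p(X ∣ M)` of `N_{n,p}(M, I_n, I_p)`. -/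
def likelihood {n p : ℕ} (X M : RealMat n p) : ℝ≥0∞ :=
  ∏ a, ∏ i, gaussianPDF (M a i) 1 (X a i)

/-- The marginal `m_π(X) = ∫ p(X ∣ M) π(M) dM ∈ [0, ∞]` of a (possibly improper) prior `π`. -/
def marginal {n p : ℕ} (π : RealMat n p → ℝ≥0∞) (X : RealMat n p) : ℝ≥0∞ :=
  ∫⁻ M, likelihood X M * π M

/-- The posterior distribution of `M` given `X`, with density `p(X ∣ M) π(M) / m_π(X)`. -/
def posterior {n p : ℕ} (π : RealMat n p → ℝ≥0∞) (X : RealMat n p) : Measure (RealMat n p) :=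
  (marginal π X)⁻¹ • volume.withDensity fun M => likelihood X M * π M

/-- The matrix quadratic loss `(D - M)ᵀ (D - M)`. -/
def quadLoss {n p : ℕ} (M D : RealMat n p) : Matrix (Fin p) (Fin p) ℝ :=
  (Matrix.of D - Matrix.of M)ᵀ * (Matrix.of D - Matrix.of M)

/-- The quadratic form `cᵀ (D - M)ᵀ (D - M) c = ‖(D - M) c‖²` of the matrix quadratic loss,
as an extended nonnegative number. -/
def quadLossForm {n p : ℕ} (c : Fin p → ℝ) (M D : RealMat n p) : ℝ≥0∞ :=
  ENNReal.ofReal (c ⬝ᵥ quadLoss M D *ᵥ c)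

/-- The matrix quadratic risk `R(M, δ) = E_M[(δ(X) - M)ᵀ (δ(X) - M)]`, entry by entry. -/
def riskMatrix {n p : ℕ} (δ : RealMat n p → RealMat n p) (M : RealMat n p) :
    Matrix (Fin p) (Fin p) ℝ :=
  Matrix.of fun i j => ∫ X, quadLoss M (δ X) i j ∂(matrixNormal M)

/-- The quadratic form `cᵀ R(M, δ) c = E_M[‖(δ(X) - M) c‖²] ∈ [0, ∞]` of the risk; it makes sense
also for estimators of infinite risk. -/
def riskForm {n p : ℕ} (δ : RealMat n p → RealMat n p) (c : Fin p → ℝ) (M : RealMat n p) :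
    ℝ≥0∞ :=
  ∫⁻ X, quadLossForm c M (δ X) ∂(matrixNormal M)

/-- Minimaxity under the matrix quadratic loss: for every `c`, the estimator attains the infimum
over all (measurable) estimators `δ'` of `sup_M cᵀ R(M, δ') c`. -/
def IsMinimax {n p : ℕ} (δ : RealMat n p → RealMat n p) : Prop :=
  Measurable δ ∧ ∀ c : Fin p → ℝ,
    (⨆ M, riskForm δ c M) =
      ⨅ δ' : {δ' : RealMat n p → RealMat n p // Measurable δ'}, ⨆ M, riskForm δ'.1 c M

/-- `δ` is a generalized Bayes estimator for the prior `π`: for every `X`, the value `δ X`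
minimizes the posterior expected matrix quadratic loss in the Löwner order, that is, every
quadratic form of it. -/
def IsGeneralizedBayes {n p : ℕ} (π : RealMat n p → ℝ≥0∞) (δ : RealMat n p → RealMat n p) :
    Prop :=
  ∀ (X D : RealMat n p) (c : Fin p → ℝ),
    ∫⁻ M, quadLossForm c M (δ X) ∂(posterior π X) ≤ ∫⁻ M, quadLossForm c M D ∂(posterior π X)

/-- The partial derivative `∂f/∂X_{ai}`. -/
def partialDeriv {n p : ℕ} (a : Fin n) (i : Fin p) (f : RealMat n p → ℝ) (X : RealMat n p) : ℝ :=
  lineDeriv ℝ f X (Pi.single a (Pi.single i 1))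

/-- The matrix gradient, `(∇̃ f)_{ai} = ∂f/∂X_{ai}`. -/
def matrixGradient {n p : ℕ} (f : RealMat n p → ℝ) (X : RealMat n p) : RealMat n p :=
  fun a i => partialDeriv a i f X

/-- The matrix Laplacian, `(Δ̃ f)_{ij} = ∑_a ∂²f/∂X_{ai}∂X_{aj}`. -/
def matrixLaplacian {n p : ℕ} (f : RealMat n p → ℝ) (X : RealMat n p) :
    Matrix (Fin p) (Fin p) ℝ :=
  Matrix.of fun i j => ∑ a, partialDeriv a i (partialDeriv a j f) X

/-- The integral of an extended-real-valued function: integral of the positive part minus integral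
of the negative part. -/
def erealIntegral {α : Type*} [MeasurableSpace α] (μ : Measure α) (f : α → EReal) : EReal :=
  ((∫⁻ x, (f x).toENNReal ∂μ : ℝ≥0∞) : EReal) - ((∫⁻ x, (-f x).toENNReal ∂μ : ℝ≥0∞) : EReal)

/-- The normalized surface measure of the unit sphere of `ℝⁿ`. -/
def unitSphereProb (n : ℕ) : Measure (Metric.sphere (0 : EuclideanSpace ℝ (Fin n)) 1) :=
  ((volume : Measure (EuclideanSpace ℝ (Fin n))).toSphere Set.univ)⁻¹ •
    (volume : Measure (EuclideanSpace ℝ (Fin n))).toSphere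

/-- `L(f : X, ρ)`, the average of `f(X + e ρᵀ)` over the unit vectors `e ∈ ℝⁿ`. -/
def rankOneAverage {n p : ℕ} (f : RealMat n p → EReal) (X : RealMat n p) (ρ : Fin p → ℝ) : EReal :=
  erealIntegral (unitSphereProb n)
    fun e => f fun a i => X a i + (e : EuclideanSpace ℝ (Fin n)) a * ρ i

/-- Matrix superharmonicity of a function with values in `ℝ ∪ {∞}`. -/
structure MatrixSuperharmonic {n p : ℕ} (f : RealMat n p → EReal) : Prop where
  ne_bot : ∀ X, f X ≠ ⊥
  lowerSemicontinuous : LowerSemicontinuous f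
  not_top : ∃ X, f X ≠ ⊤
  average_le : ∀ (X : RealMat n p) (ρ : Fin p → ℝ), rankOneAverage f X ρ ≤ f X

/-- The real-valued function `√m_π`. -/
def sqrtMarginal {n p : ℕ} (π : RealMat n p → ℝ≥0∞) (X : RealMat n p) : ℝ :=
  Real.sqrt (marginal π X).toReal

/-- The estimator `X + ∇̃ log m_π(X)`. -/
def bayesEstimator {n p : ℕ} (π : RealMat n p → ℝ≥0∞) (X : RealMat n p) : RealMat n p :=
  X + matrixGradient (fun Y => Real.log (marginal π Y).toReal) X

end

/-! Expanding the square in the Gaussian density gives `m_π(X) = e^{-‖X‖²/2} ∫ e^{⟨X,M⟩} dν(M)` with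
`ν = p(0∣M) π(M) dM` (`priorBase`). Where this Laplace transform is finite everywhere it is smooth,
the posterior is the exponential tilt of `ν`, and differentiating the log-transform produces
posterior means and covariances. Hence `X + ∇̃ log m_π` is the posterior mean, the unique minimizer
by the bias-variance decomposition.

Let `g` be the gradient and `H = Cov - I` the Hessian of `log m_π` (`tiltScore`, `tiltHess`). Then
`Δ̃√m_π / √m_π` has entries `∑_a (H_{ai,aj}/2 + g_{ai} g_{aj}/4)`. Two applications of Stein's
identity show that the risk is `n I_p` plus four times the expectation of this matrix
(`integral_risk_entry`).

Superharmonicity enters twice. Averaged over balls, it makes `m_π` finite almost everywhere along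
the slices `X + vρᵀ` through a point of finiteness; convexity of the Laplace transform then gives
finiteness everywhere (`marginal_lt_top`). Combined with a second-order Taylor expansion, it makes
`Δ̃√m_π` negative semidefinite (`MatrixSuperharmonic.sum_tiltHess_nonpos`). This inequality also
bounds `Cov` and `g` uniformly (`tilt_bounds`), which provides all the integrability that Stein's
identity needs.

Minimaxity follows because `cᵀRc ≤ n‖c‖²`, while no estimator has a smaller maximum risk: its
maximum risk is at least the Bayes risk `n‖c‖² t/(1+t)` of the prior with independent `N(0,t)`
entries, for every `t` (`iSup_riskForm_ge`). -/

/-! ### Gaussian matrices -/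

/-- The law of a matrix with independent entries `X_{ai} ∼ N(M_{ai}, v)`. -/
noncomputable def matrixNormalVar {n p : ℕ} (v : NNReal) (M : RealMat n p) :
    Measure (RealMat n p) :=
  Measure.pi fun a => Measure.pi fun i => gaussianReal (M a i) v

/-- The Lebesgue density of `matrixNormalVar v M`. -/
noncomputable def matrixNormalPDF {n p : ℕ} (v : NNReal) (M X : RealMat n p) : ℝ :=
  ∏ a, ∏ i, gaussianPDFReal (M a i) v (X a i)

theorem MeasureTheory.Measure.pi_withDensity_ofReal {ι : Type*} [Fintype ι] {α : ι → Type*}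
    [∀ i, MeasurableSpace (α i)] (μ : ∀ i, Measure (α i)) [∀ i, SigmaFinite (μ i)]
    (f : ∀ i, α i → ℝ) (hf : ∀ i, Integrable (f i) (μ i)) (hf0 : ∀ i x, 0 ≤ f i x) :
    Measure.pi (fun i => (μ i).withDensity fun x => ENNReal.ofReal (f i x)) =
      (Measure.pi μ).withDensity fun x => ENNReal.ofReal (∏ i, f i (x i)) := by
  refine Measure.pi_eq fun s hs => ?_
  rw [withDensity_apply _ (MeasurableSet.univ_pi hs), Measure.restrict_pi_pi,
    ← ofReal_integral_eq_lintegral_ofReal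
      (Integrable.fintype_prod_dep (f := f) fun i => (hf i).restrict)
      (Filter.Eventually.of_forall fun x => Finset.prod_nonneg fun i _ => hf0 i _),
    integral_fintype_prod_eq_prod (fun i => f i),
    ENNReal.ofReal_prod_of_nonneg fun i _ => integral_nonneg fun x => hf0 i x]
  refine Finset.prod_congr rfl fun i _ => ?_
  rw [withDensity_apply _ (hs i), ofReal_integral_eq_lintegral_ofReal (hf i).restrict
    (Filter.Eventually.of_forall fun x => hf0 i x)]

section
variable {n p : ℕ}

theorem matrixNormal_eq (M : RealMat n p) : matrixNormal M = matrixNormalVar 1 M := rfl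

instance (v : NNReal) (M : RealMat n p) : IsProbabilityMeasure (matrixNormalVar v M) := by
  unfold matrixNormalVar; infer_instance

instance (M : RealMat n p) : IsProbabilityMeasure (matrixNormal M) := by
  rw [matrixNormal_eq]; infer_instance

theorem matrixNormalPDF_nonneg (v : NNReal) (M X : RealMat n p) : 0 ≤ matrixNormalPDF v M X :=
  Finset.prod_nonneg fun _ _ => Finset.prod_nonneg fun _ _ => gaussianPDFReal_nonneg _ _ _

theorem matrixNormalVar_eq_withDensity {v : NNReal} (hv : v ≠ 0) (M : RealMat n p) :
    matrixNormalVar v M =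
      volume.withDensity fun X => ENNReal.ofReal (matrixNormalPDF v M X) := by
  have h1 : ∀ a, Measure.pi (fun i => gaussianReal (M a i) v) =
      volume.withDensity fun x => ENNReal.ofReal (∏ i, gaussianPDFReal (M a i) v (x i)) := by
    intro a
    have h0 := Measure.pi_withDensity_ofReal (α := fun _ : Fin p => ℝ) (fun _ => volume)
      (fun i => gaussianPDFReal (M a i) v) (fun i => integrable_gaussianPDFReal _ _)
      fun i x => gaussianPDFReal_nonneg _ _ _
    rw [volume_pi, ← h0]
    congr 1
    funext i
    exact gaussianReal_of_var_ne_zero _ hv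
  have h2 : ∀ a, Integrable (fun x : Fin p → ℝ => ∏ i, gaussianPDFReal (M a i) v (x i)) := by
    intro a
    exact Integrable.fintype_prod (f := fun i => gaussianPDFReal (M a i) v)
      fun i => integrable_gaussianPDFReal (M a i) v
  have h3 := Measure.pi_withDensity_ofReal (α := fun _ : Fin n => Fin p → ℝ) (fun _ => volume)
    (fun a x => ∏ i, gaussianPDFReal (M a i) v (x i)) h2
    fun a x => Finset.prod_nonneg fun _ _ => gaussianPDFReal_nonneg _ _ _
  unfold matrixNormalVar matrixNormalPDF
  rw [funext h1, h3]
  rfl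

theorem likelihood_eq (X M : RealMat n p) :
    likelihood X M = ENNReal.ofReal (matrixNormalPDF 1 M X) := by
  unfold likelihood matrixNormalPDF gaussianPDF
  rw [ENNReal.ofReal_prod_of_nonneg fun _ _ => Finset.prod_nonneg fun _ _ =>
    gaussianPDFReal_nonneg _ _ _]
  refine Finset.prod_congr rfl fun a _ => ?_
  rw [ENNReal.ofReal_prod_of_nonneg fun _ _ => gaussianPDFReal_nonneg _ _ _]

@[fun_prop]
theorem continuous_matrixNormalPDF (v : NNReal) :
    Continuous fun q : RealMat n p × RealMat n p => matrixNormalPDF v q.1 q.2 := by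
  unfold matrixNormalPDF
  simp only [gaussianPDFReal_def]
  fun_prop

theorem dotProduct_quadLoss (c : Fin p → ℝ) (M D : RealMat n p) :
    c ⬝ᵥ quadLoss M D *ᵥ c = ∑ a, (∑ i, D a i * c i - ∑ i, M a i * c i) ^ 2 := by
  unfold quadLoss
  rw [← Matrix.mulVec_mulVec, Matrix.dotProduct_mulVec, Matrix.vecMul_transpose]
  simp only [dotProduct, Matrix.mulVec, Matrix.sub_apply, Matrix.of_apply, sub_mul,
    Finset.sum_sub_distrib, sq]

theorem quadLoss_apply (M D : RealMat n p) (i j : Fin p) :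
    quadLoss M D i j = ∑ a, (D a i - M a i) * (D a j - M a j) := by
  simp [quadLoss, Matrix.mul_apply]

/-- Bias-variance decomposition. It serves both the minimax lower bound (normal posterior) and the
characterization of generalized Bayes estimators (exponential tilt). -/
theorem lintegral_ofReal_sum_sq {Ω ι : Type*} [Fintype ι] [MeasurableSpace Ω] (P : Measure Ω)
    [IsProbabilityMeasure P] (Z : ι → Ω → ℝ) (hZ : ∀ a, MemLp (Z a) 2 P) (d : ι → ℝ) :
    ∫⁻ ω, ENNReal.ofReal (∑ a, (d a - Z a ω) ^ 2) ∂P =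
      ENNReal.ofReal (∑ a, Var[Z a; P] + ∑ a, (d a - ∫ ω, Z a ω ∂P) ^ 2) := by
  have hi : ∀ a, Integrable (fun ω => (d a - Z a ω) ^ 2) P := fun a =>
    ((memLp_const (d a)).sub (hZ a)).integrable_sq
  rw [← ofReal_integral_eq_lintegral_ofReal (integrable_finsetSum _ fun a _ => hi a)
    (Filter.Eventually.of_forall fun ω => Finset.sum_nonneg fun a _ => sq_nonneg _),
    integral_finsetSum _ fun a _ => hi a, ← Finset.sum_add_distrib]
  congr 1
  refine Finset.sum_congr rfl fun a _ => ?_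
  have h1 := variance_eq_sub ((memLp_const (d a)).sub (hZ a))
  have h2 : Var[fun ω => d a - Z a ω; P] = Var[Z a; P] :=
    variance_const_sub (hZ a).aestronglyMeasurable _
  have h3 : ∫ ω, (d a - Z a ω) ∂P = d a - ∫ ω, Z a ω ∂P := by
    rw [integral_sub (integrable_const _) ((hZ a).integrable (by norm_num))]; simp
  have h4 : ((fun _ => d a) - Z a : Ω → ℝ) = fun ω => d a - Z a ω := rfl
  rw [h4, h2, h3] at h1
  simp only [Pi.pow_apply] at h1
  linarith

theorem memLp_row_matrixNormalVar (v : NNReal) (M : RealMat n p) (c : Fin p → ℝ) (a : Fin n) :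
    MemLp (fun X : RealMat n p => ∑ i, X a i * c i) 2 (matrixNormalVar v M) := by
  refine memLp_finsetSum _ fun i _ => MemLp.mul_const ?_ _
  have h1 : MeasurePreserving (fun X : RealMat n p => X a i) (matrixNormalVar v M)
      (gaussianReal (M a i) v) :=
    (measurePreserving_eval (fun i => gaussianReal (M a i) v) i).comp
      (measurePreserving_eval (fun a => Measure.pi fun i => gaussianReal (M a i) v) a)
  exact (memLp_id_gaussianReal' 2 (by simp)).comp_measurePreserving h1

theorem variance_row_matrixNormalVar (v : NNReal) (M : RealMat n p) (c : Fin p → ℝ) (a : Fin n) :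
    Var[fun X : RealMat n p => ∑ i, X a i * c i; matrixNormalVar v M] = v * ∑ i, c i ^ 2 := by
  have h1 := (measurePreserving_eval (fun a => Measure.pi fun i => gaussianReal (M a i) v) a)
  have h2 := h1.variance_fun_comp (f := fun x : Fin p → ℝ => ∑ i, x i * c i)
    (by exact Measurable.aemeasurable (by fun_prop))
  rw [matrixNormalVar, show (fun X : RealMat n p => ∑ i, X a i * c i) =
    fun X => (fun x : Fin p → ℝ => ∑ i, x i * c i) (Function.eval a X) from rfl, h2]
  have h3 := variance_sum_pi (μ := fun i => gaussianReal (M a i) v) (X := fun i x => x * c i)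
    fun i => (memLp_id_gaussianReal' 2 (by simp)).mul_const _
  rw [show (fun x : Fin p → ℝ => ∑ i, x i * c i) = ∑ i, fun x => x i * c i by ext; simp, h3,
    Finset.mul_sum]
  refine Finset.sum_congr rfl fun i _ => ?_
  rw [variance_mul_const, variance_fun_id_gaussianReal]

/-- The variance part does not depend on `D`, and the squared bias is dropped. Applied to the
posterior of a normal prior, this bounds the Bayes risk from below. -/
theorem lintegral_quadLossForm_matrixNormalVar_ge (v : NNReal) (M D : RealMat n p)
    (c : Fin p → ℝ) :
    ENNReal.ofReal (n * v * ∑ i, c i ^ 2) ≤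
      ∫⁻ X, quadLossForm c X D ∂(matrixNormalVar v M) := by
  unfold quadLossForm
  simp_rw [dotProduct_quadLoss]
  rw [lintegral_ofReal_sum_sq _ (fun a (X : RealMat n p) => ∑ i, X a i * c i)
    (memLp_row_matrixNormalVar v M c) fun a => ∑ i, D a i * c i]
  refine ENNReal.ofReal_le_ofReal ?_
  simp_rw [variance_row_matrixNormalVar]
  have : 0 ≤ ∑ a, (∑ i, D a i * c i -
      ∫ X : RealMat n p, ∑ i, X a i * c i ∂matrixNormalVar v M) ^ 2 :=
    Finset.sum_nonneg fun _ _ => sq_nonneg _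
  simp only [Finset.sum_const, Finset.card_univ, Fintype.card_fin, nsmul_eq_mul]
  linarith

end

/-! ### The minimax lower bound -/

section
variable {n p : ℕ}

/-- Normal conjugacy by completing the square: under the prior `N(0,t)` the marginal of `x` is
`N(0,1+t)` and the posterior of `m` is `N(tx/(1+t), t/(1+t))`. -/
theorem gaussianPDFReal_mul_gaussianPDFReal {t : NNReal} (ht : t ≠ 0) (m x : ℝ) :
    gaussianPDFReal 0 t m * gaussianPDFReal m 1 x =
      gaussianPDFReal 0 (1 + t) x * gaussianPDFReal ((t / (1 + t) : NNReal) * x) (t / (1 + t)) m := by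
  have ht' : (0 : ℝ) < t := NNReal.coe_pos.2 (pos_iff_ne_zero.2 ht)
  have hpi := Real.pi_pos
  simp only [gaussianPDFReal_def]
  rw [mul_mul_mul_comm, mul_mul_mul_comm (√(2 * Real.pi * ((1 + t : NNReal) : ℝ)))⁻¹,
    ← Real.exp_add, ← Real.exp_add, ← mul_inv, ← mul_inv,
    ← Real.sqrt_mul (by positivity), ← Real.sqrt_mul (by positivity)]
  push_cast
  congr 1
  · congr 2
    field_simp
  · congr 1
    field_simp
    ring

theorem matrixNormalPDF_mul_matrixNormalPDF {t : NNReal} (ht : t ≠ 0) (M X : RealMat n p) :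
    matrixNormalPDF t 0 M * matrixNormalPDF 1 M X =
      matrixNormalPDF (1 + t) 0 X *
        matrixNormalPDF (t / (1 + t)) (((t / (1 + t) : NNReal) : ℝ) • X) M := by
  simp only [matrixNormalPDF, ← Finset.prod_mul_distrib]
  refine Finset.prod_congr rfl fun a _ => Finset.prod_congr rfl fun i _ => ?_
  exact gaussianPDFReal_mul_gaussianPDFReal ht _ _

theorem lintegral_matrixNormalVar {v : NNReal} (hv : v ≠ 0) (M : RealMat n p)
    {f : RealMat n p → ℝ≥0∞} (hf : Measurable f) :
    ∫⁻ X, f X ∂(matrixNormalVar v M) =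
      ∫⁻ X, ENNReal.ofReal (matrixNormalPDF v M X) * f X := by
  rw [matrixNormalVar_eq_withDensity hv, lintegral_withDensity_eq_lintegral_mul _ _ hf]
  · rfl
  · exact (Continuous.measurable (f := fun X => matrixNormalPDF v M X)
      (by fun_prop)).ennreal_ofReal

theorem measurable_quadLossForm (c : Fin p → ℝ) :
    Measurable fun q : RealMat n p × RealMat n p => quadLossForm c q.1 q.2 := by
  unfold quadLossForm
  simp_rw [dotProduct_quadLoss]
  fun_prop

/-- The joint law of `(M, X)` is disintegrated in both orders: Tonelli, with conjugacy rewriting the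
joint density. -/
theorem lintegral_lintegral_matrixNormalVar_swap {t : NNReal} (ht : t ≠ 0)
    {F : RealMat n p × RealMat n p → ℝ≥0∞} (hF : Measurable F) :
    ∫⁻ M, ∫⁻ X, F (M, X) ∂(matrixNormal M) ∂(matrixNormalVar t 0) =
      ∫⁻ X, ∫⁻ M, F (M, X)
        ∂(matrixNormalVar (t / (1 + t)) (((t / (1 + t) : NNReal) : ℝ) • X))
        ∂(matrixNormalVar (1 + t) 0) := by
  have h1 : (1 : NNReal) + t ≠ 0 := by positivity
  have h2 : t / (1 + t) ≠ 0 := div_ne_zero ht h1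
  have hm : ∀ v : NNReal, Measurable fun q : RealMat n p × RealMat n p =>
      ENNReal.ofReal (matrixNormalPDF v q.1 q.2) := fun v =>
    (continuous_matrixNormalPDF v).measurable.ennreal_ofReal
  have hL : ∀ M : RealMat n p, ∫⁻ X, F (M, X) ∂(matrixNormal M) =
      ∫⁻ X, ENNReal.ofReal (matrixNormalPDF 1 M X) * F (M, X) := fun M =>
    lintegral_matrixNormalVar one_ne_zero M (hF.comp measurable_prodMk_left)
  have hR : ∀ X : RealMat n p, ∫⁻ M, F (M, X)
        ∂(matrixNormalVar (t / (1 + t)) (((t / (1 + t) : NNReal) : ℝ) • X)) =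
      ∫⁻ M, ENNReal.ofReal (matrixNormalPDF (t / (1 + t))
        (((t / (1 + t) : NNReal) : ℝ) • X) M) * F (M, X) := fun X =>
    lintegral_matrixNormalVar h2 _ (hF.comp measurable_prodMk_right)
  simp_rw [hL, hR]
  have hG : Measurable fun q : RealMat n p × RealMat n p =>
      ENNReal.ofReal (matrixNormalPDF 1 q.1 q.2) * F q := (hm 1).mul hF
  have hG' : Measurable fun q : RealMat n p × RealMat n p =>
      ENNReal.ofReal (matrixNormalPDF (t / (1 + t))
        (((t / (1 + t) : NNReal) : ℝ) • q.1) q.2) * F (q.2, q.1) := by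
    refine Measurable.mul ?_ (hF.comp measurable_swap)
    exact (hm (t / (1 + t))).comp (f := fun q : RealMat n p × RealMat n p =>
      (((t / (1 + t) : NNReal) : ℝ) • q.1, q.2)) (by fun_prop)
  rw [lintegral_matrixNormalVar ht 0 hG.lintegral_prod_right',
    lintegral_matrixNormalVar h1 0 hG'.lintegral_prod_right']
  have hL' : ∀ M : RealMat n p, ENNReal.ofReal (matrixNormalPDF t 0 M) *
      ∫⁻ X, ENNReal.ofReal (matrixNormalPDF 1 M X) * F (M, X) =
      ∫⁻ X, ENNReal.ofReal (matrixNormalPDF t 0 M * matrixNormalPDF 1 M X) * F (M, X) := by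
    intro M
    refine (lintegral_const_mul _ (hG.comp (measurable_prodMk_left (x := M)))).symm.trans
      (lintegral_congr fun X => ?_)
    rw [ENNReal.ofReal_mul (matrixNormalPDF_nonneg _ _ _), mul_assoc]; rfl
  have hR' : ∀ X : RealMat n p, ENNReal.ofReal (matrixNormalPDF (1 + t) 0 X) *
      ∫⁻ M, ENNReal.ofReal (matrixNormalPDF (t / (1 + t))
        (((t / (1 + t) : NNReal) : ℝ) • X) M) * F (M, X) =
      ∫⁻ M, ENNReal.ofReal (matrixNormalPDF t 0 M * matrixNormalPDF 1 M X) * F (M, X) := by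
    intro X
    refine (lintegral_const_mul _ (hG'.comp (measurable_prodMk_left (x := X)))).symm.trans
      (lintegral_congr fun M => ?_)
    rw [matrixNormalPDF_mul_matrixNormalPDF ht,
      ENNReal.ofReal_mul (matrixNormalPDF_nonneg _ _ _), mul_assoc]; rfl
  simp_rw [hL', hR']
  refine lintegral_lintegral_swap (Measurable.aemeasurable ?_)
  refine Measurable.mul (Measurable.ennreal_ofReal (Measurable.mul ?_ ?_)) hF
  · exact ((continuous_matrixNormalPDF t).comp
      (f := fun q : RealMat n p × RealMat n p => (0, q.1)) (by fun_prop)).measurable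
  · exact (continuous_matrixNormalPDF 1).measurable

/-- The maximum risk dominates the average risk under a normal prior, which is the average over `X`
of the posterior risk. -/
theorem iSup_riskForm_ge_of_var {δ : RealMat n p → RealMat n p} (hδ : Measurable δ)
    (c : Fin p → ℝ) {t : NNReal} (ht : t ≠ 0) :
    ENNReal.ofReal (n * (t / (1 + t) : NNReal) * ∑ i, c i ^ 2) ≤ ⨆ M, riskForm δ c M := by
  have hF : Measurable fun q : RealMat n p × RealMat n p => quadLossForm c q.1 (δ q.2) :=
    (measurable_quadLossForm c).comp (f := fun q : RealMat n p × RealMat n p => (q.1, δ q.2))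
      (by fun_prop)
  calc ENNReal.ofReal (n * (t / (1 + t) : NNReal) * ∑ i, c i ^ 2)
      = ∫⁻ _X : RealMat n p, ENNReal.ofReal (n * (t / (1 + t) : NNReal) * ∑ i, c i ^ 2)
          ∂(matrixNormalVar (1 + t) 0) := by simp
    _ ≤ ∫⁻ X, ∫⁻ M, quadLossForm c M (δ X)
        ∂(matrixNormalVar (t / (1 + t)) (((t / (1 + t) : NNReal) : ℝ) • X))
        ∂(matrixNormalVar (1 + t) 0) :=
        lintegral_mono fun X => lintegral_quadLossForm_matrixNormalVar_ge _ _ _ _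
    _ = ∫⁻ M, riskForm δ c M ∂(matrixNormalVar t 0) :=
        (lintegral_lintegral_matrixNormalVar_swap ht hF).symm
    _ ≤ ∫⁻ _M : RealMat n p, ⨆ M, riskForm δ c M ∂(matrixNormalVar t 0) :=
        lintegral_mono fun M => le_iSup (riskForm δ c) M
    _ = ⨆ M, riskForm δ c M := by simp

/-- The constant risk of the estimator `X` bounds the maximum risk of every estimator. -/
theorem iSup_riskForm_ge {δ : RealMat n p → RealMat n p} (hδ : Measurable δ) (c : Fin p → ℝ) :
    ENNReal.ofReal (n * ∑ i, c i ^ 2) ≤ ⨆ M, riskForm δ c M := by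
  -- The prior variances are `t = k + 1`, which are nonzero as conjugacy requires, and `t/(1+t) →
  -- 1`.
  have h1 : Filter.Tendsto (fun k : ℕ => ENNReal.ofReal
      (n * (((k : NNReal) + 1) / (1 + ((k : NNReal) + 1)) : NNReal) * ∑ i, c i ^ 2)) Filter.atTop
      (nhds (ENNReal.ofReal (n * 1 * ∑ i, c i ^ 2))) := by
    refine ENNReal.tendsto_ofReal ((Filter.Tendsto.const_mul _ ?_).mul_const _)
    have h2 := (tendsto_natCast_div_add_atTop (1 : ℝ)).comp (Filter.tendsto_add_atTop_nat 1)
    refine h2.congr fun k => ?_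
    push_cast [Function.comp]
    ring_nf
  rw [mul_one] at h1
  refine le_of_tendsto h1 (Filter.Eventually.of_forall fun k => ?_)
  exact iSup_riskForm_ge_of_var hδ c (by positivity)

theorem isMinimax_of_riskForm_le {δ : RealMat n p → RealMat n p} (hδ : Measurable δ)
    (h : ∀ c M, riskForm δ c M ≤ ENNReal.ofReal (n * ∑ i, c i ^ 2)) : IsMinimax δ :=
  ⟨hδ, fun c => le_antisymm
    ((iSup_le (h c)).trans (le_iInf fun δ' => iSup_riskForm_ge δ'.2 c))
    (iInf_le (fun δ' : {δ' : RealMat n p → RealMat n p // Measurable δ'} =>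
      ⨆ M, riskForm δ'.1 c M) ⟨δ, hδ⟩)⟩

end

/-! ### The marginal as a Laplace transform -/

section
variable {n p : ℕ}

/-- The Frobenius inner product `tr(Xᵀ M)`. -/
def frobInner (X M : RealMat n p) : ℝ := ∑ a, ∑ i, X a i * M a i

@[fun_prop]
theorem continuous_frobInner :
    Continuous fun q : RealMat n p × RealMat n p => frobInner q.1 q.2 := by
  unfold frobInner; fun_prop

theorem frobInner_add_left (X Y M : RealMat n p) :
    frobInner (X + Y) M = frobInner X M + frobInner Y M := by
  simp [frobInner, add_mul, Finset.sum_add_distrib]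

theorem frobInner_smul_left (t : ℝ) (X M : RealMat n p) :
    frobInner (t • X) M = t * frobInner X M := by
  simp [frobInner, Finset.mul_sum, mul_assoc]

theorem frobInner_single_left (a : Fin n) (i : Fin p) (M : RealMat n p) :
    frobInner (Pi.single a (Pi.single i 1)) M = M a i := by
  unfold frobInner
  rw [Finset.sum_eq_single a, Finset.sum_eq_single i]
  · simp
  · intro j _ hj; simp [hj]
  · simp
  · intro b _ hb; simp [hb]
  · simp

theorem matrixNormalPDF_one_eq (X M : RealMat n p) :
    matrixNormalPDF 1 M X =
      Real.exp (-(frobInner X X) / 2) * Real.exp (frobInner X M) * matrixNormalPDF 1 M 0 := by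
  unfold frobInner matrixNormalPDF
  rw [← Real.exp_add, neg_div, Finset.sum_div, ← Finset.sum_neg_distrib, ← Finset.sum_add_distrib,
    Real.exp_sum, ← Finset.prod_mul_distrib]
  refine Finset.prod_congr rfl fun a _ => ?_
  rw [Finset.sum_div, ← Finset.sum_neg_distrib, ← Finset.sum_add_distrib, Real.exp_sum,
    ← Finset.prod_mul_distrib]
  refine Finset.prod_congr rfl fun i _ => ?_
  simp only [gaussianPDFReal_def]
  rw [mul_left_comm, ← Real.exp_add]
  congr 2
  simp only [NNReal.coe_one, Pi.zero_apply]
  ring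

/-- The measure `e^{-‖M‖²/2} π(M) dM`, up to a constant, of which the marginal is the Laplace
transform times `e^{-‖X‖²/2}`. -/
noncomputable def priorBase (π : RealMat n p → ℝ≥0∞) : Measure (RealMat n p) :=
  volume.withDensity fun M => likelihood 0 M * π M

theorem measurable_likelihood (X : RealMat n p) : Measurable fun M => likelihood X M := by
  simp_rw [likelihood_eq]
  exact ((continuous_matrixNormalPDF 1).comp
    (f := fun M : RealMat n p => (M, X)) (by fun_prop)).measurable.ennreal_ofReal

theorem measurable_likelihood_mul {π : RealMat n p → ℝ≥0∞} (hπ : Measurable π)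
    (X : RealMat n p) : Measurable fun M => likelihood X M * π M :=
  (measurable_likelihood X).mul hπ

theorem withDensity_likelihood_mul {π : RealMat n p → ℝ≥0∞} (hπ : Measurable π) (X : RealMat n p) :
    (volume.withDensity fun M => likelihood X M * π M) =
      (priorBase π).withDensity fun M =>
        ENNReal.ofReal (Real.exp (-(frobInner X X) / 2) * Real.exp (frobInner X M)) := by
  unfold priorBase
  rw [← withDensity_mul _ (measurable_likelihood_mul hπ 0)]
  · congr 1
    funext M
    simp only [Pi.mul_apply]
    rw [likelihood_eq, likelihood_eq, matrixNormalPDF_one_eq X M, ENNReal.ofReal_mul (by positivity)]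
    ring
  · exact Measurable.ennreal_ofReal (Continuous.measurable (by fun_prop))

theorem marginal_eq {π : RealMat n p → ℝ≥0∞} (hπ : Measurable π) (X : RealMat n p) :
    marginal π X = ENNReal.ofReal (Real.exp (-(frobInner X X) / 2)) *
      ∫⁻ M, ENNReal.ofReal (Real.exp (frobInner X M)) ∂(priorBase π) := by
  have h := congrArg (fun μ : Measure (RealMat n p) => μ Set.univ) (withDensity_likelihood_mul hπ X)
  simp only [withDensity_apply _ MeasurableSet.univ, Measure.restrict_univ] at h
  unfold marginal
  rw [h, ← lintegral_const_mul]
  · exact lintegral_congr fun M => ENNReal.ofReal_mul (Real.exp_pos _).le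
  · exact Measurable.ennreal_ofReal (Continuous.measurable (by fun_prop))

theorem measurable_marginal {π : RealMat n p → ℝ≥0∞} (hπ : Measurable π) :
    Measurable (marginal π) := by
  unfold marginal
  refine Measurable.lintegral_prod_right' (f := fun q : RealMat n p × RealMat n p =>
    likelihood q.1 q.2 * π q.2) (Measurable.mul ?_ (hπ.comp measurable_snd))
  simp_rw [likelihood_eq]
  exact ((continuous_matrixNormalPDF 1).comp
    (f := fun q : RealMat n p × RealMat n p => (q.2, q.1)) (by fun_prop)).measurable.ennreal_ofReal

theorem marginal_lt_top_iff {π : RealMat n p → ℝ≥0∞} (hπ : Measurable π) (X : RealMat n p) :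
    marginal π X < ∞ ↔ Integrable (fun M => Real.exp (frobInner X M)) (priorBase π) := by
  rw [marginal_eq hπ, ENNReal.mul_lt_top_iff]
  have h : AEStronglyMeasurable (fun M => Real.exp (frobInner X M)) (priorBase π) :=
    Continuous.aestronglyMeasurable (by fun_prop)
  have h0 : ENNReal.ofReal (Real.exp (-(frobInner X X) / 2)) ≠ 0 := by simp [Real.exp_pos]
  simp only [Integrable, h, true_and, hasFiniteIntegral_iff_ofReal
    (Filter.Eventually.of_forall fun M => (Real.exp_pos (frobInner X M)).le), h0, false_or]
  constructor
  · rintro (h | h)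
    · exact h.2
    · simp [h]
  · exact fun h => Or.inl ⟨ENNReal.ofReal_lt_top, h⟩

/-- `⟨Z,M⟩` is the mean of `⟨X,M⟩` and `⟨Y,M⟩`, hence at most the larger one, so `e^{⟨Z,M⟩} ≤
e^{⟨X,M⟩} + e^{⟨Y,M⟩}`. -/
theorem marginal_lt_top_of_midpoint {π : RealMat n p → ℝ≥0∞} (hπ : Measurable π)
    {X Y Z : RealMat n p} (hX : marginal π X < ∞) (hY : marginal π Y < ∞)
    (hZ : X + Y = (2 : ℝ) • Z) : marginal π Z < ∞ := by
  rw [marginal_lt_top_iff hπ] at *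
  refine (hX.add hY).mono' (Continuous.aestronglyMeasurable (by fun_prop))
    (Filter.Eventually.of_forall fun M => ?_)
  have h := congrArg (fun W => frobInner W M) hZ
  simp only [frobInner_add_left, frobInner_smul_left] at h
  rw [Real.norm_of_nonneg (Real.exp_pos _).le]
  rcases le_total (frobInner Z M) (frobInner X M) with h1 | h1
  · exact (Real.exp_le_exp.2 h1).trans (le_add_of_nonneg_right (Real.exp_pos _).le)
  · exact (Real.exp_le_exp.2 (by linarith)).trans (le_add_of_nonneg_left (Real.exp_pos _).le)

theorem priorBase_ne_zero {π : RealMat n p → ℝ≥0∞} (hπ : Measurable π)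
    (hπ0 : ¬ π =ᵐ[volume] 0) : priorBase π ≠ 0 := by
  intro h
  rw [priorBase, withDensity_eq_zero_iff (measurable_likelihood_mul hπ 0).aemeasurable] at h
  refine hπ0 (h.mono fun M hM => ?_)
  have h1 : likelihood 0 M ≠ 0 := by
    unfold likelihood
    exact Finset.prod_ne_zero_iff.2 fun a _ => Finset.prod_ne_zero_iff.2 fun i _ =>
      (gaussianPDF_pos _ one_ne_zero _).ne'
  simpa [h1] using hM

theorem marginal_pos {π : RealMat n p → ℝ≥0∞} (hπ : Measurable π)
    (hπ0 : ¬ π =ᵐ[volume] 0) (X : RealMat n p) : 0 < marginal π X := by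
  rw [marginal_eq hπ]
  refine ENNReal.mul_pos (by simp [Real.exp_pos]) ?_
  rw [Ne, lintegral_eq_zero_iff (Measurable.ennreal_ofReal (Continuous.measurable (by fun_prop)))]
  intro h
  refine priorBase_ne_zero hπ hπ0 (ae_eq_bot.1 (Filter.eventually_false_iff_eq_bot.1
    (h.mono fun M hM => ?_)))
  simp only [Pi.zero_apply, ENNReal.ofReal_eq_zero] at hM
  exact absurd hM (not_le.2 (Real.exp_pos _))

end

/-! ### From sphere averages to ball averages -/

theorem lintegral_polar {E : Type*} [NormedAddCommGroup E] [NormedSpace ℝ E]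
    [FiniteDimensional ℝ E] [MeasurableSpace E] [BorelSpace E] [Nontrivial E] (μ : Measure E)
    [μ.IsAddHaarMeasure] {F : E → ℝ≥0∞} (hF : Measurable F) :
    ∫⁻ v, F v ∂μ = ∫⁻ r : Set.Ioi (0 : ℝ), ∫⁻ e : Metric.sphere (0 : E) 1, F ((r : ℝ) • (e : E))
      ∂μ.toSphere ∂(Measure.volumeIoiPow (Module.finrank ℝ E - 1)) := by
  have hG : Measurable fun y : Metric.sphere (0 : E) 1 × Set.Ioi (0 : ℝ) =>
      F ((y.2 : ℝ) • (y.1 : E)) := hF.comp (by fun_prop)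
  rw [← lintegral_prod_symm' _ hG,
    ← (μ.measurePreserving_homeomorphUnitSphereProd).lintegral_comp hG]
  have h1 : ∀ x : ({0}ᶜ : Set E), F (((homeomorphUnitSphereProd E x).2 : ℝ) •
      ((homeomorphUnitSphereProd E x).1 : E)) = F x := by
    intro x
    rw [← homeomorphUnitSphereProd_symm_apply_coe, Homeomorph.symm_apply_apply]
  simp_rw [h1]
  rw [lintegral_subtype_comap (measurableSet_singleton (0 : E)).compl,
    restrict_compl_singleton]

/-- In polar coordinates both the integral of `h` and the volume of the ball are radial integrals of
sphere integrals, and these can be compared radius by radius. -/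
theorem setLIntegral_ball_le_of_sphere_le {n : ℕ} (hn : 0 < n)
    {h : EuclideanSpace ℝ (Fin n) → ℝ≥0∞} (hh : Measurable h) {C : ℝ≥0∞}
    (hC : ∀ r : ℝ, 0 < r → ∫⁻ e, h (r • (e : EuclideanSpace ℝ (Fin n))) ∂(unitSphereProb n) ≤ C)
    (R : ℝ) :
    ∫⁻ v in Metric.ball 0 R, h v ≤ volume (Metric.ball (0 : EuclideanSpace ℝ (Fin n)) R) * C := by
  have : Nonempty (Fin n) := Fin.pos_iff_nonempty.1 hn
  set σ := (volume : Measure (EuclideanSpace ℝ (Fin n))).toSphere with hσ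
  have hσ0 : σ Set.univ ≠ 0 := by
    rw [Ne, Measure.measure_univ_eq_zero]
    exact Measure.toSphere_ne_zero _
  have hσt : σ Set.univ ≠ ∞ := measure_ne_top _ _
  have hC' : ∀ r : ℝ, 0 < r → ∫⁻ e, h (r • (e : EuclideanSpace ℝ (Fin n))) ∂σ ≤
      σ Set.univ * C := by
    intro r hr
    have h1 := hC r hr
    rw [unitSphereProb, lintegral_smul_measure, smul_eq_mul] at h1
    calc ∫⁻ e, h (r • (e : EuclideanSpace ℝ (Fin n))) ∂σ
        = σ Set.univ * ((σ Set.univ)⁻¹ * ∫⁻ e, h (r • (e : EuclideanSpace ℝ (Fin n))) ∂σ) := by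
          rw [← mul_assoc, ENNReal.mul_inv_cancel hσ0 hσt, one_mul]
      _ ≤ _ := by gcongr
  have hb : MeasurableSet (Metric.ball (0 : EuclideanSpace ℝ (Fin n)) R) := measurableSet_ball
  rw [← lintegral_indicator hb, lintegral_polar _ (hh.indicator hb), ← setLIntegral_one,
    ← lintegral_indicator hb, lintegral_polar _ (measurable_const.indicator hb),
    ← lintegral_mul_const _ ?_]
  · refine lintegral_mono fun r => ?_
    have hr : ∀ e : Metric.sphere (0 : EuclideanSpace ℝ (Fin n)) 1,
        ((r : ℝ) • (e : EuclideanSpace ℝ (Fin n))) ∈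
          Metric.ball (0 : EuclideanSpace ℝ (Fin n)) R ↔ (r : ℝ) < R := by
      intro e
      have he : ‖(e : EuclideanSpace ℝ (Fin n))‖ = 1 := by simp
      rw [mem_ball_zero_iff, norm_smul, he, Real.norm_of_nonneg (le_of_lt r.2), mul_one]
    by_cases hrR : (r : ℝ) < R
    · simp only [Set.indicator, hr, hrR, if_true, lintegral_one]
      exact hC' r r.2
    · simp [Set.indicator, hr, hrR]
  · refine Measurable.lintegral_prod_right' (f := fun y : Set.Ioi (0 : ℝ) ×
      Metric.sphere (0 : EuclideanSpace ℝ (Fin n)) 1 => (Metric.ball 0 R).indicator (fun _ => 1)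
        ((y.1 : ℝ) • (y.2 : EuclideanSpace ℝ (Fin n))))
      ((measurable_const.indicator hb).comp (by fun_prop))

section
variable {n p : ℕ}

/-- The matrix `X + v ρᵀ`. -/
def rankOneShift (X : RealMat n p) (ρ : Fin p → ℝ) (v : EuclideanSpace ℝ (Fin n)) : RealMat n p :=
  fun a i => X a i + v a * ρ i

@[fun_prop]
theorem continuous_rankOneShift (X : RealMat n p) (ρ : Fin p → ℝ) :
    Continuous (rankOneShift X ρ) := by
  unfold rankOneShift; fun_prop

theorem MatrixSuperharmonic.setLIntegral_ball_le (hn : 0 < n) {f : RealMat n p → ℝ≥0∞}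
    (hf : Measurable f) (hs : MatrixSuperharmonic fun X => (f X : EReal)) (X : RealMat n p)
    (ρ : Fin p → ℝ) (R : ℝ) :
    ∫⁻ v in Metric.ball 0 R, f (rankOneShift X ρ v) ≤
      volume (Metric.ball (0 : EuclideanSpace ℝ (Fin n)) R) * f X := by
  refine setLIntegral_ball_le_of_sphere_le hn (h := fun v => f (rankOneShift X ρ v))
    (hf.comp (continuous_rankOneShift X ρ).measurable) (fun r _ => ?_) R
  -- Scaling `ρ` by `r` turns the average over the unit sphere into one over the sphere of radius
  -- `r`. The negative part of the extended integral vanishes because `f` takes values in `ℝ≥0∞`.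
  have h := hs.average_le X (r • ρ)
  have h0 : ∀ x : ℝ≥0∞, (-(x : EReal)).toENNReal = 0 := fun x =>
    EReal.toENNReal_of_nonpos (by simpa using EReal.coe_ennreal_nonneg x)
  simp only [rankOneAverage, erealIntegral, EReal.toENNReal_coe, h0, lintegral_zero,
    EReal.coe_ennreal_zero, sub_zero, EReal.coe_ennreal_le_coe_ennreal_iff] at h
  refine le_of_eq_of_le (lintegral_congr fun e => ?_) h
  congr 1
  funext a i
  simp only [rankOneShift, PiLp.smul_apply, smul_eq_mul, Pi.smul_apply]
  ring

/-- Finite ball averages give finiteness only for almost every `v`. The reflection `v ↦ 2w - v`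
preserves Lebesgue measure, so some `v` and its reflection are both good, and `w` is their midpoint.
-/
theorem marginal_lt_top_rankOneShift (hn : 0 < n) {π : RealMat n p → ℝ≥0∞} (hπ : Measurable π)
    (hs : MatrixSuperharmonic
      fun X : RealMat n p => (((marginal π X) ^ (1 / 2 : ℝ) : ℝ≥0∞) : EReal))
    {X : RealMat n p} (hX : marginal π X < ∞) (ρ : Fin p → ℝ) (w : EuclideanSpace ℝ (Fin n)) :
    marginal π (rankOneShift X ρ w) < ∞ := by
  set f : RealMat n p → ℝ≥0∞ := fun X => (marginal π X) ^ (1 / 2 : ℝ) with hfdef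
  have hf : Measurable f := (measurable_marginal hπ).pow_const _
  have hfX : f X ≠ ∞ := ENNReal.rpow_ne_top_of_nonneg (by norm_num) hX.ne
  have hae : ∀ᵐ v : EuclideanSpace ℝ (Fin n), f (rankOneShift X ρ v) < ∞ := by
    have h1 : ∀ k : ℕ, ∀ᵐ v ∂(volume.restrict (Metric.ball (0 : EuclideanSpace ℝ (Fin n)) k)),
        f (rankOneShift X ρ v) < ∞ := fun k =>
      ae_lt_top (hf.comp (continuous_rankOneShift X ρ).measurable)
        (ne_top_of_le_ne_top (ENNReal.mul_ne_top measure_ball_lt_top.ne hfX)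
          (hs.setLIntegral_ball_le hn hf X ρ k))
    have h2 := ae_all_iff.2 fun k : ℕ => (ae_restrict_iff' measurableSet_ball).1 (h1 k)
    filter_upwards [h2] with v hv
    obtain ⟨k, hk⟩ := exists_nat_gt ‖v‖
    exact hv k (by simpa using hk)
  have hae' : ∀ᵐ v : EuclideanSpace ℝ (Fin n), f (rankOneShift X ρ ((w + w) - v)) < ∞ :=
    (Measure.measurePreserving_sub_left volume (w + w)).quasiMeasurePreserving.ae hae
  obtain ⟨v, h1, h2⟩ := (hae.and hae').exists
  have h3 : ∀ Y, f Y < ∞ → marginal π Y < ∞ := fun Y hY =>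
    (ENNReal.rpow_lt_top_iff_of_pos (by norm_num)).1 hY
  refine marginal_lt_top_of_midpoint hπ (h3 _ h1) (h3 _ h2) ?_
  funext a i
  simp only [rankOneShift, Pi.add_apply, Pi.smul_apply, smul_eq_mul, PiLp.sub_apply,
    PiLp.add_apply]
  ring

theorem marginal_lt_top (hn : 0 < n) {π : RealMat n p → ℝ≥0∞} (hπ : Measurable π)
    (hs : MatrixSuperharmonic
      fun X : RealMat n p => (((marginal π X) ^ (1 / 2 : ℝ) : ℝ≥0∞) : EReal))
    (X : RealMat n p) : marginal π X < ∞ := by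
  obtain ⟨X₀, h0⟩ := hs.not_top
  have h1 : marginal π X₀ < ∞ := by
    rw [lt_top_iff_ne_top]
    rintro h
    exact h0 (by simp [h])
  -- `X - X₀` need not have rank one, so the columns are exchanged one at a time; each exchange is a
  -- shift with `ρ` a coordinate vector.
  have key : ∀ s : Finset (Fin p),
      marginal π (fun a i => if i ∈ s then X a i else X₀ a i) < ∞ := by
    intro s
    induction s using Finset.induction_on with
    | empty => simpa using h1
    | insert j s hj ih =>
      convert marginal_lt_top_rankOneShift hn hπ hs ih (Pi.single j 1)
        (WithLp.toLp 2 fun a => X a j - X₀ a j) using 2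
      funext a i
      by_cases hij : i = j
      · subst hij
        simp [rankOneShift, hj]
      · simp [rankOneShift, hij]
  simpa using key Finset.univ

end

/-! ### Moments of a Laplace transform -/

section
variable {n p : ℕ}

theorem abs_entry_le_norm (M : RealMat n p) (a : Fin n) (i : Fin p) : |M a i| ≤ ‖M‖ :=
  (norm_le_pi_norm (M a) i).trans (norm_le_pi_norm M a)

theorem frobInner_le_norm_mul_norm (X M : RealMat n p) :
    frobInner X M ≤ n * p * (‖X‖ * ‖M‖) := by
  unfold frobInner
  calc ∑ a, ∑ i, X a i * M a i ≤ ∑ _a : Fin n, ∑ _i : Fin p, ‖X‖ * ‖M‖ := by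
        refine Finset.sum_le_sum fun a _ => Finset.sum_le_sum fun i _ => ?_
        refine (le_abs_self _).trans ?_
        rw [abs_mul]
        exact mul_le_mul (abs_entry_le_norm X a i) (abs_entry_le_norm M a i) (abs_nonneg _)
          (norm_nonneg _)
    _ = n * p * (‖X‖ * ‖M‖) := by simp [mul_assoc]

/-- The sup norm is governed by single entries, and the two signs account for the absolute value.
The summand `1` makes `log B` nonnegative, also when there are no entries. -/
theorem exp_mul_norm_le {s : ℝ} (hs : 0 ≤ s) (M : RealMat n p) :
    Real.exp (s * ‖M‖) ≤
      1 + ∑ a, ∑ i, (Real.exp (s * M a i) + Real.exp (-s * M a i)) := by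
  set B := 1 + ∑ a, ∑ i, (Real.exp (s * M a i) + Real.exp (-s * M a i)) with hB
  have hB1 : 1 ≤ B := le_add_of_nonneg_right
    (Finset.sum_nonneg fun a _ => Finset.sum_nonneg fun i _ => by positivity)
  have h1 : ∀ a i, Real.exp (s * M a i) + Real.exp (-s * M a i) ≤ B := by
    intro a i
    have h2 := Finset.single_le_sum (s := Finset.univ)
      (f := fun i => Real.exp (s * M a i) + Real.exp (-s * M a i))
      (fun i _ => by positivity) (Finset.mem_univ i)
    have h3 := Finset.single_le_sum (s := Finset.univ)
      (f := fun a => ∑ i, (Real.exp (s * M a i) + Real.exp (-s * M a i)))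
      (fun a _ => Finset.sum_nonneg fun i _ => by positivity) (Finset.mem_univ a)
    linarith
  rw [← Real.le_log_iff_exp_le (by linarith), ← Real.norm_of_nonneg hs, ← norm_smul]
  refine (pi_norm_le_iff_of_nonneg (Real.log_nonneg hB1)).2 fun a =>
    (pi_norm_le_iff_of_nonneg (Real.log_nonneg hB1)).2 fun i => ?_
  rw [Real.le_log_iff_exp_le (by linarith), Real.norm_eq_abs]
  simp only [Pi.smul_apply, smul_eq_mul]
  rcases abs_cases (s * M a i) with h | h <;> rw [h.1]
  · exact (le_add_of_nonneg_right (Real.exp_pos _).le).trans (h1 a i)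
  · rw [← neg_mul]
    exact (le_add_of_nonneg_left (Real.exp_pos _).le).trans (h1 a i)

theorem integrable_exp_frobInner_add_norm {ν : Measure (RealMat n p)}
    (hν : ∀ X, Integrable (fun M => Real.exp (frobInner X M)) ν) (X : RealMat n p) {s : ℝ}
    (hs : 0 ≤ s) : Integrable (fun M => Real.exp (frobInner X M + s * ‖M‖)) ν := by
  have h1 : ∀ (t : ℝ) (a : Fin n) (i : Fin p), Integrable
      (fun M => Real.exp (frobInner X M) * Real.exp (t * M a i)) ν := by
    intro t a i
    -- The factor `e^{t M_{ai}}` is absorbed by moving the argument `X` along one coordinate.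
    refine (hν (X + t • (Pi.single a (Pi.single i 1) : RealMat n p))).congr (Filter.Eventually.of_forall fun M => ?_)
    simp only
    rw [frobInner_add_left, frobInner_smul_left, frobInner_single_left, Real.exp_add]
  have h2 : Integrable (fun M => Real.exp (frobInner X M) +
      ∑ a, ∑ i, (Real.exp (frobInner X M) * Real.exp (s * M a i) +
        Real.exp (frobInner X M) * Real.exp (-s * M a i))) ν :=
    (hν X).add (integrable_finsetSum _ fun a _ => integrable_finsetSum _ fun i _ =>
      (h1 s a i).add (h1 (-s) a i))
  refine h2.mono' (Continuous.aestronglyMeasurable (by fun_prop))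
    (Filter.Eventually.of_forall fun M => ?_)
  rw [Real.norm_of_nonneg (Real.exp_pos _).le, Real.exp_add]
  refine (mul_le_mul_of_nonneg_left (exp_mul_norm_le hs M) (Real.exp_pos _).le).trans_eq ?_
  simp only [mul_add, mul_one, Finset.mul_sum]

/-- Measurable functions of at most exponential growth. -/
def ExpBounded (q : RealMat n p → ℝ) : Prop :=
  Measurable q ∧ ∃ C k : ℝ, 0 ≤ k ∧ ∀ M, |q M| ≤ C * Real.exp (k * ‖M‖)

theorem ExpBounded.mul_entry {q : RealMat n p → ℝ} (hq : ExpBounded q) (a : Fin n) (i : Fin p) :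
    ExpBounded fun M => q M * M a i := by
  obtain ⟨hm, C, k, hk, hb⟩ := hq
  refine ⟨by fun_prop, C, k + 1, by linarith, fun M => ?_⟩
  have h1 : |M a i| ≤ Real.exp ‖M‖ :=
    (abs_entry_le_norm M a i).trans (by linarith [Real.add_one_le_exp ‖M‖])
  rw [abs_mul, add_mul, one_mul, Real.exp_add, ← mul_assoc]
  exact mul_le_mul (hb M) h1 (abs_nonneg _) ((abs_nonneg _).trans (hb M))

theorem expBounded_one : ExpBounded fun _ : RealMat n p => (1 : ℝ) :=
  ⟨measurable_const, 1, 0, le_rfl, fun M => by simp⟩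

theorem ExpBounded.integrable {q : RealMat n p → ℝ} (hq : ExpBounded q)
    {ν : Measure (RealMat n p)}
    (hν : ∀ X, Integrable (fun M => Real.exp (frobInner X M)) ν) (X : RealMat n p) :
    Integrable (fun M => q M * Real.exp (frobInner X M)) ν := by
  obtain ⟨hm, C, k, hk, hb⟩ := hq
  refine ((integrable_exp_frobInner_add_norm hν X hk).const_mul C).mono'
    (hm.mul (Continuous.measurable (by fun_prop))).aestronglyMeasurable
    (Filter.Eventually.of_forall fun M => ?_)
  rw [norm_mul, Real.norm_eq_abs, Real.norm_of_nonneg (Real.exp_pos _).le, add_comm, Real.exp_add,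
    ← mul_assoc]
  exact mul_le_mul_of_nonneg_right (hb M) (Real.exp_pos _).le

/-- The evaluation of an entry, as a continuous linear map. -/
def entryCLM (a : Fin n) (i : Fin p) : RealMat n p →L[ℝ] ℝ :=
  (ContinuousLinearMap.proj (R := ℝ) (φ := fun _ : Fin p => ℝ) i).comp
    (ContinuousLinearMap.proj (R := ℝ) (φ := fun _ : Fin n => Fin p → ℝ) a)

@[simp]
theorem entryCLM_apply (a : Fin n) (i : Fin p) (X : RealMat n p) : entryCLM a i X = X a i := rfl

theorem hasFDerivAt_frobInner (X M : RealMat n p) :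
    HasFDerivAt (fun Y => frobInner Y M) (∑ a, ∑ i, M a i • entryCLM a i) X := by
  have h : (fun Y => frobInner Y M) = ⇑(∑ a, ∑ i, M a i • entryCLM a i : RealMat n p →L[ℝ] ℝ) := by
    funext Y
    simp [frobInner, mul_comm]
  rw [h]
  exact ContinuousLinearMap.hasFDerivAt _

/-- `∫ q(M) e^{⟨X, M⟩} dν(M)`. -/
noncomputable def laplaceMoment (ν : Measure (RealMat n p)) (q : RealMat n p → ℝ)
    (X : RealMat n p) : ℝ :=
  ∫ M, q M * Real.exp (frobInner X M) ∂ν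

theorem integrable_sum_smul_entryCLM {ν : Measure (RealMat n p)}
    {c : Fin n → Fin p → RealMat n p → ℝ} (hc : ∀ a i, Integrable (c a i) ν) :
    Integrable (fun M => (∑ a, ∑ i, c a i M • entryCLM a i : RealMat n p →L[ℝ] ℝ)) ν :=
  integrable_finsetSum Finset.univ
    (f := fun a M => (∑ i, c a i M • entryCLM a i : RealMat n p →L[ℝ] ℝ)) fun a _ =>
      integrable_finsetSum Finset.univ
        (f := fun i M => (c a i M • entryCLM a i : RealMat n p →L[ℝ] ℝ)) fun i _ =>
          (hc a i).smul_const _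

theorem integral_sum_smul_entryCLM {ν : Measure (RealMat n p)}
    {c : Fin n → Fin p → RealMat n p → ℝ} (hc : ∀ a i, Integrable (c a i) ν) :
    ∫ M, (∑ a, ∑ i, c a i M • entryCLM a i : RealMat n p →L[ℝ] ℝ) ∂ν =
      ∑ a, ∑ i, (∫ M, c a i M ∂ν) • entryCLM a i := by
  rw [integral_finsetSum Finset.univ
    (f := fun a M => (∑ i, c a i M • entryCLM a i : RealMat n p →L[ℝ] ℝ)) fun a _ =>
      integrable_finsetSum Finset.univ
        (f := fun i M => (c a i M • entryCLM a i : RealMat n p →L[ℝ] ℝ)) fun i _ =>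
          (hc a i).smul_const _]
  refine Finset.sum_congr rfl fun a _ => ?_
  rw [integral_finsetSum Finset.univ
    (f := fun i M => (c a i M • entryCLM a i : RealMat n p →L[ℝ] ℝ)) fun i _ =>
      (hc a i).smul_const _]
  exact Finset.sum_congr rfl fun i _ => integral_smul_const (c a i) _

theorem norm_sum_smul_entryCLM_le (c : Fin n → Fin p → ℝ) :
    ‖(∑ a, ∑ i, c a i • entryCLM a i : RealMat n p →L[ℝ] ℝ)‖ ≤
      ∑ a, ∑ i, |c a i| * ‖entryCLM (n := n) (p := p) a i‖ := by
  refine (norm_sum_le _ _).trans (Finset.sum_le_sum fun a _ => (norm_sum_le _ _).trans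
    (Finset.sum_le_sum fun i _ => ?_))
  rw [norm_smul, Real.norm_eq_abs]

theorem hasFDerivAt_laplaceMoment {ν : Measure (RealMat n p)}
    (hν : ∀ X, Integrable (fun M => Real.exp (frobInner X M)) ν) {q : RealMat n p → ℝ}
    (hq : ExpBounded q) (X : RealMat n p) :
    HasFDerivAt (laplaceMoment ν q)
      (∑ a, ∑ i, laplaceMoment ν (fun M => q M * M a i) X • entryCLM a i) X := by
  have hI : ∀ a i, Integrable (fun M => q M * M a i * Real.exp (frobInner X M)) ν :=
    fun a i => (hq.mul_entry a i).integrable hν X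
  have hint := hq.integrable hν X
  obtain ⟨hm, C, k, hk, hb⟩ := hq
  have hC : 0 ≤ C := by
    have := (abs_nonneg _).trans (hb 0)
    simpa using this
  have h1 : (∑ a, ∑ i, laplaceMoment ν (fun M => q M * M a i) X • entryCLM a i) =
      ∫ M, (∑ a, ∑ i, (q M * M a i * Real.exp (frobInner X M)) • entryCLM a i :
        RealMat n p →L[ℝ] ℝ) ∂ν := (integral_sum_smul_entryCLM hI).symm
  have h2 : AEStronglyMeasurable (fun M => (∑ a, ∑ i, (q M * M a i *
      Real.exp (frobInner X M)) • entryCLM a i : RealMat n p →L[ℝ] ℝ)) ν :=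
    (integrable_sum_smul_entryCLM hI).aestronglyMeasurable
  have h3 : ∀ Y, AEStronglyMeasurable (fun M => q M * Real.exp (frobInner Y M)) ν := fun Y =>
    (hm.mul (Continuous.measurable (by fun_prop))).aestronglyMeasurable
  -- Dominating function on the unit ball around `X`: in the exponent, `k` comes from `q`, `1` from
  -- `|M_{ai}| ≤ e^{‖M‖}`, and `n * p` from `⟨Y - X, M⟩ ≤ np‖M‖`.
  have h4 : Integrable (fun M => ∑ a : Fin n, ∑ i : Fin p,
      (C * ‖entryCLM (n := n) (p := p) a i‖) *
        Real.exp (frobInner X M + (k + 1 + n * p) * ‖M‖)) ν :=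
    integrable_finsetSum _ fun a _ => integrable_finsetSum _ fun i _ =>
      (integrable_exp_frobInner_add_norm hν X (by positivity)).const_mul _
  rw [h1]
  refine hasFDerivAt_integral_of_dominated_of_fderiv_le (𝕜 := ℝ) (s := Metric.ball X 1)
    (F' := fun Y M => (∑ a, ∑ i, (q M * M a i * Real.exp (frobInner Y M)) • entryCLM a i :
      RealMat n p →L[ℝ] ℝ))
    (Metric.ball_mem_nhds X one_pos) (Filter.Eventually.of_forall h3) hint h2
    (Filter.Eventually.of_forall fun M Y hY => ?_) h4
    (Filter.Eventually.of_forall fun M Y _ => ?_)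
  · refine (norm_sum_smul_entryCLM_le _).trans
      (Finset.sum_le_sum fun a _ => Finset.sum_le_sum fun i _ => ?_)
    have h1 : |M a i| ≤ Real.exp ‖M‖ :=
      (abs_entry_le_norm M a i).trans (by linarith [Real.add_one_le_exp ‖M‖])
    have h2 : frobInner Y M ≤ frobInner X M + n * p * ‖M‖ := by
      have h3 := frobInner_add_left X (Y - X) M
      rw [add_sub_cancel] at h3
      have h4 := frobInner_le_norm_mul_norm (Y - X) M
      have h5 : ‖Y - X‖ ≤ 1 := by rw [← dist_eq_norm]; exact (Metric.mem_ball.1 hY).le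
      have h6 : (n * p : ℝ) * (‖Y - X‖ * ‖M‖) ≤ n * p * (1 * ‖M‖) := by gcongr
      linarith
    rw [abs_mul, abs_mul, Real.abs_exp]
    calc |q M| * |M a i| * Real.exp (frobInner Y M) * ‖entryCLM (n := n) (p := p) a i‖
        ≤ C * Real.exp (k * ‖M‖) * Real.exp ‖M‖ * Real.exp (frobInner X M + n * p * ‖M‖) *
          ‖entryCLM (n := n) (p := p) a i‖ := by
          gcongr
          exact hb M
      _ = _ := by
          rw [show frobInner X M + (k + 1 + n * p) * ‖M‖ =
            k * ‖M‖ + ‖M‖ + (frobInner X M + n * p * ‖M‖) by ring, Real.exp_add (_ + _),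
            Real.exp_add (k * ‖M‖)]
          ring
  · refine (((hasFDerivAt_frobInner Y M).exp).const_mul (q M)).congr_fderiv ?_
    simp only [Finset.smul_sum, smul_smul]
    refine Finset.sum_congr rfl fun a _ => Finset.sum_congr rfl fun i _ => ?_
    congr 1
    ring

/-- Derivatives of Laplace moments are combinations of Laplace moments with `q` multiplied by an
entry, so the class is closed under differentiation. -/
theorem contDiff_laplaceMoment {ν : Measure (RealMat n p)}
    (hν : ∀ X, Integrable (fun M => Real.exp (frobInner X M)) ν) (k : ℕ) {q : RealMat n p → ℝ}
    (hq : ExpBounded q) : ContDiff ℝ k (laplaceMoment ν q) := by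
  induction k generalizing q with
  | zero =>
    rw [Nat.cast_zero, contDiff_zero]
    exact continuous_iff_continuousAt.2 fun X => (hasFDerivAt_laplaceMoment hν hq X).continuousAt
  | succ k ih =>
    rw [Nat.cast_succ, contDiff_succ_iff_hasFDerivAt]
    refine ⟨_, ?_, hasFDerivAt_laplaceMoment hν hq⟩
    exact ContDiff.sum fun a _ => ContDiff.sum fun i _ => (ih (hq.mul_entry a i)).smul contDiff_const

theorem partialDeriv_of_hasFDerivAt {f : RealMat n p → ℝ} {f' : RealMat n p →L[ℝ] ℝ}
    {X : RealMat n p} (h : HasFDerivAt f f' X) (a : Fin n) (i : Fin p) :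
    partialDeriv a i f X = f' (Pi.single a (Pi.single i 1)) :=
  (h.hasLineDerivAt _).lineDeriv

theorem sum_smul_entryCLM_single (c : Fin n → Fin p → ℝ) (a : Fin n) (i : Fin p) :
    (∑ b, ∑ j, c b j • entryCLM b j : RealMat n p →L[ℝ] ℝ) (Pi.single a (Pi.single i 1)) =
      c a i := by
  have h := frobInner_single_left a i c
  simp only [frobInner] at h
  rw [← h]
  simp [mul_comm]

end

/-! ### The second-order form of superharmonicity -/

section
variable {n : ℕ}

theorem continuous_integrableOn_ball {h : EuclideanSpace ℝ (Fin n) → ℝ} (hc : Continuous h)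
    (R : ℝ) : IntegrableOn h (Metric.ball 0 R) :=
  (hc.continuousOn.integrableOn_compact (isCompact_closedBall 0 R)).mono_set
    Metric.ball_subset_closedBall

theorem setIntegral_ball_comp_isometry
    (U : EuclideanSpace ℝ (Fin n) ≃ₗᵢ[ℝ] EuclideanSpace ℝ (Fin n))
    (f : EuclideanSpace ℝ (Fin n) → ℝ) (R : ℝ) :
    ∫ v in Metric.ball 0 R, f (U v) = ∫ v in Metric.ball 0 R, f v := by
  have h := U.measurePreserving.setIntegral_preimage_emb
    U.toHomeomorph.measurableEmbedding f (Metric.ball 0 R)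
  rwa [U.preimage_ball, map_zero] at h

/-- Reflecting coordinate `a` preserves the ball and changes the sign of the integrand. -/
theorem setIntegral_ball_entry_mul_entry_of_ne {a b : Fin n} (hab : a ≠ b) (R : ℝ) :
    ∫ v : EuclideanSpace ℝ (Fin n) in Metric.ball 0 R, v a * v b = 0 := by
  have h := setIntegral_ball_comp_isometry (LinearIsometryEquiv.piLpCongrRight 2
    fun c : Fin n => if c = a then LinearIsometryEquiv.neg ℝ (E := ℝ)
      else LinearIsometryEquiv.refl ℝ ℝ) (fun v => v a * v b) R
  simp [hab.symm, integral_neg] at h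
  linarith

theorem setIntegral_ball_entry_sq (a b : Fin n) (R : ℝ) :
    ∫ v : EuclideanSpace ℝ (Fin n) in Metric.ball 0 R, v a * v a =
      ∫ v : EuclideanSpace ℝ (Fin n) in Metric.ball 0 R, v b * v b := by
  have h := setIntegral_ball_comp_isometry (LinearIsometryEquiv.piLpCongrLeft 2 ℝ ℝ
    (Equiv.swap a b)) (fun v => v b * v b) R
  simpa using h

theorem setIntegral_ball_entry (a : Fin n) (R : ℝ) :
    ∫ v : EuclideanSpace ℝ (Fin n) in Metric.ball 0 R, v a = 0 := by
  have h := setIntegral_ball_comp_isometry (LinearIsometryEquiv.neg ℝ) (fun v => v a) R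
  simp [integral_neg] at h
  linarith

theorem setIntegral_ball_entry_sq_pos (a : Fin n) {R : ℝ} (hR : 0 < R) :
    0 < ∫ v : EuclideanSpace ℝ (Fin n) in Metric.ball 0 R, v a * v a := by
  rw [setIntegral_pos_iff_support_of_nonneg_ae
    (Filter.Eventually.of_forall fun v => mul_self_nonneg _)
    (continuous_integrableOn_ball (by fun_prop) R)]
  have ho : IsOpen (Function.support (fun v : EuclideanSpace ℝ (Fin n) => v a * v a) ∩
      Metric.ball 0 R) :=
    (Continuous.isOpen_support (by fun_prop)).inter Metric.isOpen_ball
  refine ho.measure_pos _ ⟨EuclideanSpace.single a (R / 2), ?_, ?_⟩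
  · simp [hR.ne']
  · simp [abs_of_pos hR, hR]

/-- The Taylor lower bound is integrated over a small ball. By symmetry the linear and off-diagonal
terms vanish and the diagonal terms share one second moment `κ`, so only the trace of `B` survives.
-/
theorem sum_diag_nonpos_of_ball_average_le {h : EuclideanSpace ℝ (Fin n) → ℝ}
    (hc : Continuous h) {l : Fin n → ℝ} {B : Fin n → Fin n → ℝ}
    (hT : ∀ ε > 0, ∃ δ > 0, ∀ v, ‖v‖ < δ →
      h 0 + ∑ a, v a * l a + (1 / 2) * ∑ a, ∑ b, v a * v b * B a b - ε * ‖v‖ ^ 2 ≤ h v)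
    (hR : ∀ R > 0, ∫ v in Metric.ball 0 R, h v ≤
      volume.real (Metric.ball (0 : EuclideanSpace ℝ (Fin n)) R) * h 0) :
    ∑ a, B a a ≤ 0 := by
  rcases Nat.eq_zero_or_pos n with rfl | hn
  · simp
  let a₀ : Fin n := ⟨0, hn⟩
  refine le_of_forall_pos_le_add fun ε hε => ?_
  -- Since `∫ ‖v‖² = nκ`, the remainder integrates to `κ ε / 2`, to be compared with `κ/2` times the
  -- trace.
  obtain ⟨δ, hδ, hT⟩ := hT (ε / (2 * n)) (by positivity)
  set κ := ∫ v : EuclideanSpace ℝ (Fin n) in Metric.ball 0 δ, v a₀ * v a₀ with hκ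
  have hκ0 : 0 < κ := setIntegral_ball_entry_sq_pos a₀ hδ
  have i0 : IntegrableOn (fun _ : EuclideanSpace ℝ (Fin n) => h 0) (Metric.ball 0 δ) :=
    continuous_integrableOn_ball continuous_const δ
  have i1 : ∀ a, IntegrableOn (fun v : EuclideanSpace ℝ (Fin n) => v a * l a)
      (Metric.ball 0 δ) := fun a => continuous_integrableOn_ball (by fun_prop) δ
  have i2 : ∀ a b, IntegrableOn (fun v : EuclideanSpace ℝ (Fin n) => v a * v b * B a b)
      (Metric.ball 0 δ) := fun a b => continuous_integrableOn_ball (by fun_prop) δ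
  have i3 : ∀ a, IntegrableOn (fun v : EuclideanSpace ℝ (Fin n) => v a * v a)
      (Metric.ball 0 δ) := fun a => continuous_integrableOn_ball (by fun_prop) δ
  have e1 : ∫ v : EuclideanSpace ℝ (Fin n) in Metric.ball 0 δ, ∑ a, v a * l a = 0 := by
    rw [integral_finsetSum _ fun a _ => i1 a]
    simp [integral_mul_const, setIntegral_ball_entry]
  have e2 : ∫ v : EuclideanSpace ℝ (Fin n) in Metric.ball 0 δ, ∑ a, ∑ b, v a * v b * B a b =
      κ * ∑ a, B a a := by
    rw [integral_finsetSum _ fun a _ => integrable_finsetSum _ fun b _ => i2 a b, Finset.mul_sum]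
    refine Finset.sum_congr rfl fun a _ => ?_
    rw [integral_finsetSum _ fun b _ => i2 a b, Finset.sum_eq_single a]
    · rw [integral_mul_const, setIntegral_ball_entry_sq a a₀]
    · intro b _ hb
      rw [integral_mul_const, setIntegral_ball_entry_mul_entry_of_ne hb.symm, zero_mul]
    · simp
  have e3 : ∫ v : EuclideanSpace ℝ (Fin n) in Metric.ball 0 δ, ‖v‖ ^ 2 = n * κ := by
    have : ∀ v : EuclideanSpace ℝ (Fin n), ‖v‖ ^ 2 = ∑ a, v a * v a := fun v => by
      rw [EuclideanSpace.real_norm_sq_eq]; simp [sq]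
    simp_rw [this]
    rw [integral_finsetSum _ fun a _ => i3 a]
    simp [fun a => setIntegral_ball_entry_sq a a₀ δ, hκ]
  have j1 : IntegrableOn (fun v : EuclideanSpace ℝ (Fin n) => ∑ a, v a * l a)
      (Metric.ball 0 δ) := continuous_integrableOn_ball (by fun_prop) δ
  have j2 : IntegrableOn (fun v : EuclideanSpace ℝ (Fin n) =>
      (1 / 2) * ∑ a, ∑ b, v a * v b * B a b) (Metric.ball 0 δ) :=
    continuous_integrableOn_ball (by fun_prop) δ
  have j3 : IntegrableOn (fun v : EuclideanSpace ℝ (Fin n) => ε / (2 * n) * ‖v‖ ^ 2)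
      (Metric.ball 0 δ) := continuous_integrableOn_ball (by fun_prop) δ
  have key := (setIntegral_mono_on ((((i0.add j1).add j2).sub j3))
    (continuous_integrableOn_ball hc δ) measurableSet_ball
    fun v hv => hT v (by simpa using hv)).trans (hR δ hδ)
  rw [integral_sub' ((i0.add j1).add j2) j3, integral_add' (i0.add j1) j2, integral_add' i0 j1,
    e1, integral_const_mul, integral_const_mul, e2, e3, setIntegral_const, smul_eq_mul] at key
  have hn' : (0 : ℝ) < n := by exact_mod_cast hn
  have h5 : ε / (2 * n) * (n * κ) = κ * (ε / 2) := by field_simp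
  have h6 : κ * (∑ a, B a a) ≤ κ * ε := by linarith
  linarith [le_of_mul_le_mul_left h6 hκ0]

end

/-- The remainder, as a function of `Z`, has derivative `Du(X+Z) - Du(X) - D²u(X)Z`, by symmetry of
`D²u`. This is at most `ε‖Z‖` near `0`, and the mean value inequality on the ball of radius `‖Y‖`
contributes the second factor `‖Y‖`. -/
theorem ContDiff.exists_taylor_two {F : Type*} [NormedAddCommGroup F] [NormedSpace ℝ F]
    {u : F → ℝ} (hu : ContDiff ℝ 2 u) (X : F) {ε : ℝ} (hε : 0 < ε) :
    ∃ δ > 0, ∀ Y, ‖Y‖ < δ →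
      |u (X + Y) - u X - fderiv ℝ u X Y - (1 / 2) * fderiv ℝ (fderiv ℝ u) X Y Y| ≤
        ε * ‖Y‖ ^ 2 := by
  set D := fderiv ℝ u X
  set D2 := fderiv ℝ (fderiv ℝ u) X
  have hsymm : ∀ v w, D2 v w = D2 w v := fun v w =>
    (hu.contDiffAt (x := X)).isSymmSndFDerivAt (by simp) v w
  have hd : ∀ Y, HasFDerivAt u (fderiv ℝ u Y) Y := fun Y =>
    (hu.differentiable (by norm_num) Y).hasFDerivAt
  have hd2 : HasFDerivAt (fderiv ℝ u) D2 X :=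
    ((hu.fderiv_right (m := 1) (by norm_num)).differentiable (by norm_num) X).hasFDerivAt
  rw [hasFDerivAt_iff_isLittleO_nhds_zero, Asymptotics.isLittleO_iff] at hd2
  obtain ⟨δ, hδ, hb⟩ := Metric.eventually_nhds_iff.1 (hd2 hε)
  refine ⟨δ, hδ, fun Y hY => ?_⟩
  have hφ : ∀ Z, HasFDerivAt (fun Z => u (X + Z) - D Z - (1 / 2) * D2 Z Z)
      (fderiv ℝ u (X + Z) - D - D2 Z) Z := by
    intro Z
    have h1 : HasFDerivAt (fun Z => u (X + Z)) (fderiv ℝ u (X + Z)) Z :=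
      (hasFDerivAt_comp_add_left X).2 (hd (X + Z))
    have h2 : HasFDerivAt (fun Z => D2 Z Z) (D2.flip Z + D2 Z) Z := by
      have h3 := (D2.hasFDerivAt (x := Z)).clm_apply (hasFDerivAt_id Z)
      refine h3.congr_fderiv ?_
      ext w
      simp [add_comm]
    refine ((h1.sub D.hasFDerivAt).sub (h2.const_mul (1 / 2))).congr_fderiv ?_
    ext w
    simp only [sub_apply, smul_apply, add_apply, ContinuousLinearMap.flip_apply, smul_eq_mul,
      hsymm w Z]
    ring
  have key := (convex_closedBall (0 : F) ‖Y‖).norm_image_sub_le_of_norm_hasFDerivWithin_le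
    (C := ε * ‖Y‖) (fun Z _ => (hφ Z).hasFDerivWithinAt) (fun Z hZ => ?_)
    (Metric.mem_closedBall_self (norm_nonneg _)) (y := Y) (by simp)
  · simp only [add_zero, map_zero, sub_zero, mul_zero, Real.norm_eq_abs] at key
    convert key using 1
    · congr 1; ring
    · ring
  · have hZ' : ‖Z‖ ≤ ‖Y‖ := by simpa using hZ
    have := hb (y := Z) (by simpa using hZ'.trans_lt hY)
    refine this.trans ?_
    gcongr

section
variable {n p : ℕ}

/-- The matrix `e_a ρᵀ`. -/
def rowMatrix (ρ : Fin p → ℝ) (a : Fin n) : RealMat n p := Pi.single a ρ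

theorem rankOneShift_eq (X : RealMat n p) (ρ : Fin p → ℝ) (v : EuclideanSpace ℝ (Fin n)) :
    rankOneShift X ρ v = X + ∑ a, v a • rowMatrix ρ a := by
  funext a i
  simp [rankOneShift, rowMatrix, Finset.sum_apply, Pi.single_apply, apply_ite]

theorem sum_fderiv_fderiv_nonpos {u : RealMat n p → ℝ} (hu : ContDiff ℝ 2 u) (X : RealMat n p)
    (ρ : Fin p → ℝ)
    (hR : ∀ R > 0, ∫ v in Metric.ball 0 R, u (rankOneShift X ρ v) ≤
      volume.real (Metric.ball (0 : EuclideanSpace ℝ (Fin n)) R) * u X) :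
    ∑ a, fderiv ℝ (fderiv ℝ u) X (rowMatrix ρ a) (rowMatrix ρ a) ≤ 0 := by
  have h0 : rankOneShift X ρ (0 : EuclideanSpace ℝ (Fin n)) = X := by
    simp [rankOneShift_eq]
  refine sum_diag_nonpos_of_ball_average_le (h := fun v => u (rankOneShift X ρ v))
    (hu.continuous.comp (continuous_rankOneShift X ρ))
    (l := fun a => fderiv ℝ u X (rowMatrix ρ a))
    (B := fun a b => fderiv ℝ (fderiv ℝ u) X (rowMatrix ρ a) (rowMatrix ρ b)) (fun ε hε => ?_)
    (by simpa only [h0] using hR)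
  -- `C` bounds the norm of the linear map `v ↦ vρᵀ`; the summand `1` keeps it positive when `ρ =
  -- 0`.
  set C := 1 + ∑ a : Fin n, ‖rowMatrix ρ a‖ with hC
  have hC0 : 0 < C := by positivity
  obtain ⟨δ, hδ, hT⟩ := hu.exists_taylor_two X (ε := ε / C ^ 2) (by positivity)
  refine ⟨δ / C, by positivity, fun v hv => ?_⟩
  set Y : RealMat n p := ∑ a, v a • rowMatrix ρ a with hY
  have hYn : ‖Y‖ ≤ C * ‖v‖ := by
    refine (norm_sum_le _ _).trans ?_
    rw [hC, add_mul, one_mul, Finset.sum_mul]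
    refine le_add_of_nonneg_of_le (norm_nonneg _) (Finset.sum_le_sum fun a _ => ?_)
    rw [norm_smul, mul_comm]
    gcongr
    exact PiLp.norm_apply_le v a
  have h1 := hT Y (hYn.trans_lt (by rwa [lt_div_iff₀' hC0] at hv))
  have h2 : ε / C ^ 2 * ‖Y‖ ^ 2 ≤ ε * ‖v‖ ^ 2 := by
    calc ε / C ^ 2 * ‖Y‖ ^ 2 ≤ ε / C ^ 2 * (C * ‖v‖) ^ 2 := by gcongr
      _ = ε * ‖v‖ ^ 2 := by field_simp
  have h3 : fderiv ℝ u X Y = ∑ a, v a * fderiv ℝ u X (rowMatrix ρ a) := by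
    simp [hY, map_sum]
  have h4 : fderiv ℝ (fderiv ℝ u) X Y Y =
      ∑ a, ∑ b, v a * v b * fderiv ℝ (fderiv ℝ u) X (rowMatrix ρ a) (rowMatrix ρ b) := by
    rw [hY]
    simp only [map_sum, map_smul, sum_apply, smul_apply, smul_eq_mul, Finset.mul_sum]
    rw [Finset.sum_comm]
    refine Finset.sum_congr rfl fun a _ => Finset.sum_congr rfl fun b _ => by ring
  rw [h3, h4] at h1
  have h5 := (abs_le.1 h1).1
  simp only [h0]
  rw [rankOneShift_eq]
  linarith

end

/-! ### Exponential tilts: mean and covariance -/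

section
variable {n p : ℕ} {ν : Measure (RealMat n p)}

/-- The exponential tilt of `ν` by `⟨X, ·⟩`. -/
noncomputable def expTilt (ν : Measure (RealMat n p)) (X : RealMat n p) :
    Measure (RealMat n p) :=
  ν.tilted fun M => frobInner X M

/-- The mean of the exponential tilt. -/
noncomputable def tiltMean (ν : Measure (RealMat n p)) (X : RealMat n p) : RealMat n p :=
  fun a i => ∫ M, M a i ∂(expTilt ν X)

/-- The covariances of the exponential tilt. -/
noncomputable def tiltCov (ν : Measure (RealMat n p)) (X : RealMat n p)
    (a : Fin n) (i : Fin p) (b : Fin n) (j : Fin p) : ℝ :=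
  cov[fun M => M a i, fun M => M b j; expTilt ν X]

/-- The Laplace transform of `ν`. -/
noncomputable def laplaceTransform (ν : Measure (RealMat n p)) : RealMat n p → ℝ :=
  laplaceMoment ν fun _ => 1

theorem isProbabilityMeasure_expTilt [NeZero ν]
    (hν : ∀ X, Integrable (fun M => Real.exp (frobInner X M)) ν) (X : RealMat n p) :
    IsProbabilityMeasure (expTilt ν X) :=
  isProbabilityMeasure_tilted (hν X)

theorem laplaceTransform_eq (X : RealMat n p) :
    laplaceTransform ν X = ∫ M, Real.exp (frobInner X M) ∂ν := by
  simp [laplaceTransform, laplaceMoment]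

theorem laplaceTransform_pos [NeZero ν]
    (hν : ∀ X, Integrable (fun M => Real.exp (frobInner X M)) ν) (X : RealMat n p) :
    0 < laplaceTransform ν X := by
  rw [laplaceTransform_eq]
  exact integral_exp_pos (hν X)

theorem integral_expTilt (q : RealMat n p → ℝ) (X : RealMat n p) :
    ∫ M, q M ∂(expTilt ν X) = laplaceMoment ν q X / laplaceTransform ν X := by
  rw [expTilt, integral_tilted, laplaceTransform_eq, laplaceMoment, ← integral_div]
  refine integral_congr_ae (Filter.Eventually.of_forall fun M => ?_)
  simp only [smul_eq_mul]
  ring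

theorem ExpBounded.integrable_expTilt {q : RealMat n p → ℝ} (hq : ExpBounded q)
    (hν : ∀ X, Integrable (fun M => Real.exp (frobInner X M)) ν) (X : RealMat n p) :
    Integrable q (expTilt ν X) := by
  rw [expTilt, integrable_tilted_iff (hν X)]
  simpa only [smul_eq_mul, mul_comm] using hq.integrable hν X

theorem expBounded_entry (a : Fin n) (i : Fin p) : ExpBounded fun M : RealMat n p => M a i := by
  simpa using (expBounded_one (n := n) (p := p)).mul_entry a i

theorem memLp_entry_expTilt
    (hν : ∀ X, Integrable (fun M => Real.exp (frobInner X M)) ν) (X : RealMat n p)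
    (a : Fin n) (i : Fin p) : MemLp (fun M => M a i) 2 (expTilt ν X) := by
  rw [memLp_two_iff_integrable_sq (Continuous.aestronglyMeasurable (by fun_prop))]
  simpa only [sq] using ((expBounded_entry a i).mul_entry a i).integrable_expTilt hν X

theorem tiltCov_comm (X : RealMat n p) (a : Fin n) (i : Fin p) (b : Fin n) (j : Fin p) :
    tiltCov ν X a i b j = tiltCov ν X b j a i := covariance_comm _ _

theorem tiltMean_eq (X : RealMat n p) (a : Fin n) (i : Fin p) :
    tiltMean ν X a i = laplaceMoment ν (fun M => M a i) X / laplaceTransform ν X :=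
  integral_expTilt _ _

theorem tiltCov_eq [NeZero ν]
    (hν : ∀ X, Integrable (fun M => Real.exp (frobInner X M)) ν) (X : RealMat n p)
    (a : Fin n) (i : Fin p) (b : Fin n) (j : Fin p) :
    tiltCov ν X a i b j = laplaceMoment ν (fun M => M a i * M b j) X / laplaceTransform ν X -
      tiltMean ν X a i * tiltMean ν X b j := by
  have := isProbabilityMeasure_expTilt hν X
  rw [tiltCov, covariance_eq_sub (memLp_entry_expTilt hν X a i) (memLp_entry_expTilt hν X b j),
    ← integral_expTilt]
  rfl

theorem tiltCov_self_nonneg (X : RealMat n p) (a : Fin n) (i : Fin p) :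
    0 ≤ tiltCov ν X a i a i := by
  rw [tiltCov, covariance_self (Continuous.aemeasurable (by fun_prop))]
  exact variance_nonneg _ _

/-- The variances of the sum and of the difference of the two entries are nonnegative. -/
theorem abs_tiltCov_le [NeZero ν]
    (hν : ∀ X, Integrable (fun M => Real.exp (frobInner X M)) ν) (X : RealMat n p)
    (a : Fin n) (i : Fin p) (b : Fin n) (j : Fin p) :
    |tiltCov ν X a i b j| ≤ (tiltCov ν X a i a i + tiltCov ν X b j b j) / 2 := by
  have := isProbabilityMeasure_expTilt hν X
  have ha := memLp_entry_expTilt hν X a i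
  have hb := memLp_entry_expTilt hν X b j
  have h1 := variance_add ha hb
  have h2 := variance_sub ha hb
  have h3 := variance_nonneg ((fun M => M a i) + fun M => M b j) (expTilt ν X)
  have h4 := variance_nonneg ((fun M => M a i) - fun M => M b j) (expTilt ν X)
  unfold tiltCov
  rw [covariance_self ha.aemeasurable, covariance_self hb.aemeasurable, abs_le]
  constructor <;> linarith

/-! ### Derivatives of the log-Laplace transform -/

theorem sum_sub_smul_entryCLM (c d : Fin n → Fin p → ℝ) :
    (∑ a, ∑ i, (c a i - d a i) • entryCLM a i : RealMat n p →L[ℝ] ℝ) =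
      ∑ a, ∑ i, c a i • entryCLM a i - ∑ a, ∑ i, d a i • entryCLM a i := by
  ext Z
  simp [sub_mul, Finset.sum_sub_distrib]

theorem sum_add_smul_entryCLM (c d : Fin n → Fin p → ℝ) :
    (∑ a, ∑ i, (c a i + d a i) • entryCLM a i : RealMat n p →L[ℝ] ℝ) =
      ∑ a, ∑ i, c a i • entryCLM a i + ∑ a, ∑ i, d a i • entryCLM a i := by
  ext Z
  simp [add_mul, Finset.sum_add_distrib]

theorem sum_mul_smul_entryCLM (t : ℝ) (c : Fin n → Fin p → ℝ) :
    (∑ a, ∑ i, (t * c a i) • entryCLM a i : RealMat n p →L[ℝ] ℝ) =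
      t • ∑ a, ∑ i, c a i • entryCLM a i := by
  simp only [Finset.smul_sum, smul_smul]

theorem contDiff_laplaceTransform
    (hν : ∀ X, Integrable (fun M => Real.exp (frobInner X M)) ν) :
    ContDiff ℝ 2 (laplaceTransform ν) :=
  contDiff_laplaceMoment hν 2 expBounded_one

theorem hasFDerivAt_laplaceTransform [NeZero ν]
    (hν : ∀ X, Integrable (fun M => Real.exp (frobInner X M)) ν) (X : RealMat n p) :
    HasFDerivAt (laplaceTransform ν)
      (laplaceTransform ν X • ∑ a, ∑ i, tiltMean ν X a i • entryCLM a i) X := by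
  refine (hasFDerivAt_laplaceMoment hν expBounded_one X).congr_fderiv ?_
  have h0 := (laplaceTransform_pos hν X).ne'
  simp only [Finset.smul_sum, smul_smul, tiltMean_eq, mul_div_cancel₀ _ h0, one_mul]

/-- The second cumulant: the quotient rule turns the derivative of the tilted mean into second
moment minus product of means. -/
theorem hasFDerivAt_tiltMean [NeZero ν]
    (hν : ∀ X, Integrable (fun M => Real.exp (frobInner X M)) ν) (a : Fin n) (i : Fin p)
    (X : RealMat n p) :
    HasFDerivAt (fun Y => tiltMean ν Y a i)
      (∑ b, ∑ j, tiltCov ν X a i b j • entryCLM b j) X := by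
  have h0 := (laplaceTransform_pos hν X).ne'
  have h1 := (hasFDerivAt_laplaceMoment hν (expBounded_entry a i) X).fun_mul
    ((hasDerivAt_inv h0).comp_hasFDerivAt X (hasFDerivAt_laplaceTransform hν X))
  have h2 : (fun Y => tiltMean ν Y a i) =
      fun Y => laplaceMoment ν (fun M => M a i) Y * (laplaceTransform ν Y)⁻¹ :=
    funext fun Y => (tiltMean_eq Y a i).trans (div_eq_mul_inv _ _)
  rw [h2]
  refine h1.congr_fderiv ?_
  simp only [← sum_mul_smul_entryCLM, ← sum_add_smul_entryCLM, tiltCov_eq hν]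
  refine Finset.sum_congr rfl fun b _ => Finset.sum_congr rfl fun j _ => ?_
  congr 1
  rw [tiltMean_eq X a i]
  simp only [Function.comp]
  field_simp
  ring

/-- The gradient of the log-Laplace transform minus `‖X‖²/2`. -/
noncomputable def tiltScore (ν : Measure (RealMat n p)) (X : RealMat n p) : RealMat n p :=
  fun a i => tiltMean ν X a i - X a i

/-- The derivatives of the entries of `tiltScore`. -/
noncomputable def tiltHess (ν : Measure (RealMat n p)) (X : RealMat n p)
    (a : Fin n) (i : Fin p) (b : Fin n) (j : Fin p) : ℝ :=
  tiltCov ν X a i b j - if a = b ∧ i = j then 1 else 0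

theorem tiltHess_comm (X : RealMat n p) (a : Fin n) (i : Fin p) (b : Fin n) (j : Fin p) :
    tiltHess ν X a i b j = tiltHess ν X b j a i := by
  simp only [tiltHess, tiltCov_comm X a i b j, eq_comm]

theorem hasFDerivAt_tiltScore [NeZero ν]
    (hν : ∀ X, Integrable (fun M => Real.exp (frobInner X M)) ν) (a : Fin n) (i : Fin p)
    (X : RealMat n p) :
    HasFDerivAt (fun Y => tiltScore ν Y a i)
      (∑ b, ∑ j, tiltHess ν X a i b j • entryCLM b j) X := by
  refine ((hasFDerivAt_tiltMean hν a i X).sub (entryCLM a i).hasFDerivAt).congr_fderiv ?_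
  have h : (∑ b, ∑ j, (if a = b ∧ i = j then (1 : ℝ) else 0) • entryCLM b j) =
      entryCLM (n := n) (p := p) a i := by
    rw [Finset.sum_eq_single a, Finset.sum_eq_single i] <;> simp +contextual [eq_comm]
  rw [← h]
  simp only [tiltHess]
  rw [sum_sub_smul_entryCLM]

theorem hasFDerivAt_frobInner_self (X : RealMat n p) :
    HasFDerivAt (fun Y => frobInner Y Y / 2) (∑ a, ∑ i, X a i • entryCLM a i) X := by
  have h : (fun Y : RealMat n p => frobInner Y Y / 2) =
      fun Y => ∑ a, ∑ i, entryCLM a i Y ^ 2 * (1 / 2) := by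
    funext Y
    simp only [frobInner, Finset.sum_div, entryCLM_apply, sq, div_eq_mul_one_div (_ * _) (2 : ℝ)]
  rw [h]
  refine HasFDerivAt.fun_sum fun a _ => HasFDerivAt.fun_sum fun i _ => ?_
  have h1 := ((entryCLM a i).hasFDerivAt (x := X)).pow 2
  refine (h1.mul_const (1 / 2)).congr_fderiv ?_
  ext Z
  simp
  ring

/-- The logarithm of `e^{-‖X‖²/2}` times the Laplace transform. -/
noncomputable def logMixture (ν : Measure (RealMat n p)) (X : RealMat n p) : ℝ :=
  Real.log (laplaceTransform ν X) - frobInner X X / 2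

theorem hasFDerivAt_logMixture [NeZero ν]
    (hν : ∀ X, Integrable (fun M => Real.exp (frobInner X M)) ν) (X : RealMat n p) :
    HasFDerivAt (logMixture ν) (∑ a, ∑ i, tiltScore ν X a i • entryCLM a i) X := by
  have h0 := (laplaceTransform_pos hν X).ne'
  refine (((hasFDerivAt_laplaceTransform hν X).log h0).sub
    (hasFDerivAt_frobInner_self X)).congr_fderiv ?_
  rw [smul_smul, inv_mul_cancel₀ h0, one_smul]
  simp only [tiltScore]
  rw [sum_sub_smul_entryCLM]

/-- The square root of `e^{-‖X‖²/2}` times the Laplace transform. -/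
noncomputable def sqrtMixture (ν : Measure (RealMat n p)) (X : RealMat n p) : ℝ :=
  Real.exp (logMixture ν X * (1 / 2))

theorem contDiff_sqrtMixture [NeZero ν]
    (hν : ∀ X, Integrable (fun M => Real.exp (frobInner X M)) ν) :
    ContDiff ℝ 2 (sqrtMixture ν) := by
  have h1 : ContDiff ℝ 2 fun X => Real.log (laplaceTransform ν X) :=
    (contDiff_laplaceTransform hν).log fun X => (laplaceTransform_pos hν X).ne'
  have h2 : ContDiff ℝ 2 fun X : RealMat n p => frobInner X X / 2 := by
    unfold frobInner
    fun_prop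
  exact ((h1.sub h2).mul contDiff_const).exp

theorem hasFDerivAt_sqrtMixture [NeZero ν]
    (hν : ∀ X, Integrable (fun M => Real.exp (frobInner X M)) ν) (X : RealMat n p) :
    HasFDerivAt (sqrtMixture ν)
      (∑ a, ∑ i, (sqrtMixture ν X * tiltScore ν X a i * (1 / 2)) • entryCLM a i) X := by
  refine (((hasFDerivAt_logMixture hν X).mul_const (1 / 2)).exp).congr_fderiv ?_
  simp only [Finset.smul_sum, smul_smul, sqrtMixture]
  refine Finset.sum_congr rfl fun a _ => Finset.sum_congr rfl fun i _ => ?_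
  congr 1
  ring

/-- The differentiated function is a first partial derivative of `√m`, so this computes the second
ones: `√m (H/2 + g g/4)`. -/
theorem hasFDerivAt_sqrtMixture_mul_tiltScore [NeZero ν]
    (hν : ∀ X, Integrable (fun M => Real.exp (frobInner X M)) ν) (a : Fin n) (i : Fin p)
    (X : RealMat n p) :
    HasFDerivAt (fun Y => sqrtMixture ν Y * tiltScore ν Y a i * (1 / 2))
      (∑ b, ∑ j, (sqrtMixture ν X * (tiltHess ν X a i b j / 2 +
        tiltScore ν X a i * tiltScore ν X b j / 4)) • entryCLM b j) X := by
  refine (((hasFDerivAt_sqrtMixture hν X).mul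
    (hasFDerivAt_tiltScore hν a i X)).mul_const (1 / 2)).congr_fderiv ?_
  simp only [← sum_mul_smul_entryCLM, ← sum_add_smul_entryCLM]
  refine Finset.sum_congr rfl fun b _ => Finset.sum_congr rfl fun j _ => ?_
  congr 1
  ring

theorem partialDeriv_sqrtMixture [NeZero ν]
    (hν : ∀ X, Integrable (fun M => Real.exp (frobInner X M)) ν) (a : Fin n) (i : Fin p) :
    partialDeriv a i (sqrtMixture ν) = fun X => sqrtMixture ν X * tiltScore ν X a i * (1 / 2) := by
  funext X
  rw [partialDeriv_of_hasFDerivAt (hasFDerivAt_sqrtMixture hν X), sum_smul_entryCLM_single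
    fun a i => sqrtMixture ν X * tiltScore ν X a i * (1 / 2)]

theorem matrixLaplacian_sqrtMixture [NeZero ν]
    (hν : ∀ X, Integrable (fun M => Real.exp (frobInner X M)) ν) (X : RealMat n p)
    (i j : Fin p) :
    matrixLaplacian (sqrtMixture ν) X i j = sqrtMixture ν X *
      ∑ a, (tiltHess ν X a i a j / 2 + tiltScore ν X a i * tiltScore ν X a j / 4) := by
  simp only [matrixLaplacian, Matrix.of_apply, partialDeriv_sqrtMixture hν, Finset.mul_sum]
  refine Finset.sum_congr rfl fun a _ => ?_
  rw [partialDeriv_of_hasFDerivAt (hasFDerivAt_sqrtMixture_mul_tiltScore hν a j X),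
    sum_smul_entryCLM_single fun b k => sqrtMixture ν X * (tiltHess ν X a j b k / 2 +
        tiltScore ν X a j * tiltScore ν X b k / 4), tiltHess_comm]
  ring

theorem sum_smul_entryCLM_rowMatrix (c : Fin n → Fin p → ℝ) (ρ : Fin p → ℝ) (a : Fin n) :
    (∑ b, ∑ j, c b j • entryCLM b j : RealMat n p →L[ℝ] ℝ) (rowMatrix ρ a) =
      ∑ j, ρ j * c a j := by
  simp only [sum_apply, smul_apply, entryCLM_apply, smul_eq_mul]
  rw [Finset.sum_eq_single a]
  · simp [rowMatrix, mul_comm]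
  · intro b _ hb
    simp [rowMatrix, hb]
  · simp

/-- Translates the second-order form of superharmonicity, stated along `e_a ρᵀ`, into scores and
covariances. -/
theorem fderiv_fderiv_sqrtMixture_rowMatrix [NeZero ν]
    (hν : ∀ X, Integrable (fun M => Real.exp (frobInner X M)) ν) (X : RealMat n p)
    (ρ : Fin p → ℝ) (a : Fin n) :
    fderiv ℝ (fderiv ℝ (sqrtMixture ν)) X (rowMatrix ρ a) (rowMatrix ρ a) =
      ∑ i, ∑ j, ρ i * ρ j * (sqrtMixture ν X * (tiltHess ν X a i a j / 2 +
        tiltScore ν X a i * tiltScore ν X a j / 4)) := by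
  have hd2 : HasFDerivAt (fderiv ℝ (sqrtMixture ν)) (fderiv ℝ (fderiv ℝ (sqrtMixture ν)) X) X :=
    (((contDiff_sqrtMixture hν).fderiv_right (m := 1) (by norm_num)).differentiable
      (by norm_num) X).hasFDerivAt
  have h1 := hd2.clm_apply (hasFDerivAt_const (rowMatrix ρ a) X)
  have h2 : (fun Y => fderiv ℝ (sqrtMixture ν) Y (rowMatrix ρ a)) =
      fun Y => ∑ i, ρ i * (sqrtMixture ν Y * tiltScore ν Y a i * (1 / 2)) := by
    funext Y
    rw [(hasFDerivAt_sqrtMixture hν Y).fderiv,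
      sum_smul_entryCLM_rowMatrix fun a i => sqrtMixture ν Y * tiltScore ν Y a i * (1 / 2)]
  rw [h2] at h1
  have h3 := HasFDerivAt.fun_sum (u := Finset.univ) fun i _ =>
    (hasFDerivAt_sqrtMixture_mul_tiltScore hν a i X).const_mul (ρ i)
  have h4 := congrArg (fun T : RealMat n p →L[ℝ] ℝ => T (rowMatrix ρ a)) (h1.unique h3)
  simp only [add_apply, ContinuousLinearMap.comp_apply, zero_apply, map_zero, zero_add,
    ContinuousLinearMap.flip_apply] at h4
  rw [h4, sum_apply]
  refine Finset.sum_congr rfl fun i _ => ?_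
  rw [smul_apply, smul_eq_mul, sum_smul_entryCLM_rowMatrix fun b j => sqrtMixture ν X *
    (tiltHess ν X a i b j / 2 + tiltScore ν X a i * tiltScore ν X b j / 4), Finset.mul_sum]
  exact Finset.sum_congr rfl fun j _ => by ring

end

/-! ### Stein's identity -/

section
variable {n p : ℕ}

theorem hasFDerivAt_matrixNormalPDF (M X : RealMat n p) :
    HasFDerivAt (matrixNormalPDF 1 M)
      (∑ a, ∑ i, (matrixNormalPDF 1 M X * (M a i - X a i)) • entryCLM a i) X := by
  have h : matrixNormalPDF 1 M =
      fun Y => Real.exp (frobInner Y M - frobInner Y Y / 2) * matrixNormalPDF 1 M 0 := by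
    funext Y
    rw [matrixNormalPDF_one_eq, ← Real.exp_add]
    congr 2
    ring
  have h1 := (((hasFDerivAt_frobInner X M).sub (hasFDerivAt_frobInner_self X)).exp).mul_const
    (matrixNormalPDF 1 M 0)
  rw [← sum_sub_smul_entryCLM] at h1
  rw [h]
  refine h1.congr_fderiv ?_
  rw [sum_mul_smul_entryCLM, smul_smul, mul_comm]
  rfl

theorem integral_matrixNormal (M : RealMat n p) (f : RealMat n p → ℝ) :
    ∫ X, f X ∂(matrixNormal M) = ∫ X, matrixNormalPDF 1 M X * f X := by
  have hm : Measurable (matrixNormalPDF 1 M) := Continuous.measurable (by fun_prop)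
  rw [matrixNormal_eq, matrixNormalVar_eq_withDensity one_ne_zero,
    integral_withDensity_eq_integral_toReal_smul hm.ennreal_ofReal (by simp)]
  simp_rw [ENNReal.toReal_ofReal (matrixNormalPDF_nonneg _ _ _), smul_eq_mul]

theorem integrable_matrixNormal_iff (M : RealMat n p) (f : RealMat n p → ℝ) :
    Integrable f (matrixNormal M) ↔ Integrable fun X => matrixNormalPDF 1 M X * f X := by
  have hm : Measurable (matrixNormalPDF 1 M) := Continuous.measurable (by fun_prop)
  rw [matrixNormal_eq, matrixNormalVar_eq_withDensity one_ne_zero,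
    integrable_withDensity_iff_integrable_smul' hm.ennreal_ofReal (by simp)]
  simp_rw [ENNReal.toReal_ofReal (matrixNormalPDF_nonneg _ _ _), smul_eq_mul]

/-- Integration by parts, since `∂p(X∣M)/∂X_{ai} = -(X_{ai} - M_{ai}) p(X∣M)`. -/
theorem integral_sub_mul_eq_integral_deriv (M : RealMat n p) (a : Fin n) (i : Fin p)
    {h : RealMat n p → ℝ} {h' : RealMat n p → Fin n → Fin p → ℝ}
    (hd : ∀ X, HasFDerivAt h (∑ b, ∑ j, h' X b j • entryCLM b j) X)
    (hi : Integrable h (matrixNormal M))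
    (hi' : Integrable (fun X => h' X a i) (matrixNormal M))
    (hxi : Integrable (fun X => (X a i - M a i) * h X) (matrixNormal M)) :
    ∫ X, (X a i - M a i) * h X ∂(matrixNormal M) = ∫ X, h' X a i ∂(matrixNormal M) := by
  set v : RealMat n p := Pi.single a (Pi.single i 1) with hv
  have e1 : ∀ X, fderiv ℝ h X v = h' X a i := fun X => by
    rw [(hd X).fderiv, hv, sum_smul_entryCLM_single (h' X)]
  have e2 : ∀ X, fderiv ℝ (matrixNormalPDF 1 M) X v =
      matrixNormalPDF 1 M X * (M a i - X a i) := fun X => by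
    rw [(hasFDerivAt_matrixNormalPDF M X).fderiv, hv,
      sum_smul_entryCLM_single fun a i => matrixNormalPDF 1 M X * (M a i - X a i)]
  have e3 : ∀ X, matrixNormalPDF 1 M X * (M a i - X a i) * h X =
      -(matrixNormalPDF 1 M X * ((X a i - M a i) * h X)) := fun X => by ring
  rw [integrable_matrixNormal_iff] at hi hi' hxi
  have key := integral_mul_fderiv_eq_neg_fderiv_mul_of_integrable (𝕜 := ℝ)
    (μ := (volume : Measure (RealMat n p)))
    (f := matrixNormalPDF 1 M) (g := h) (v := v) (by simp only [e2, e3]; exact hxi.neg)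
    (by simpa only [e1] using hi') hi
    (fun X _ => (hasFDerivAt_matrixNormalPDF M X).differentiableAt)
    fun X _ => (hd X).differentiableAt
  simp only [e1, e2, e3, integral_neg, neg_neg] at key
  rw [integral_matrixNormal, integral_matrixNormal, key]

theorem memLp_sub_matrixNormal (M : RealMat n p) (a : Fin n) (i : Fin p) :
    MemLp (fun X : RealMat n p => X a i - M a i) 2 (matrixNormal M) := by
  have h := memLp_row_matrixNormalVar 1 M (Pi.single i 1) a
  rw [← matrixNormal_eq] at h
  refine MemLp.sub ?_ (memLp_const _)
  simpa [Pi.single_apply] using h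

/-! ### The risk of a matrix superharmonic mixture -/

variable {ν : Measure (RealMat n p)}

/-- With `c` a coordinate vector, `hH` reads `∑_b (Cov_{bi,bi}/2 + g_{bi}²/4) ≤ n/2`, because the
`-1` in each diagonal entry of `H` contributes `-1/2`. All summands are nonnegative, so each obeys
the bound. -/
theorem tilt_bounds
    (hH : ∀ (X : RealMat n p) (c : Fin p → ℝ), ∑ a, ∑ i, ∑ j, c i * c j *
      (tiltHess ν X a i a j / 2 + tiltScore ν X a i * tiltScore ν X a j / 4) ≤ 0)
    (X : RealMat n p) (a : Fin n) (i : Fin p) :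
    tiltCov ν X a i a i ≤ n ∧ tiltScore ν X a i ^ 2 ≤ 2 * n := by
  have h := hH X (Pi.single i 1)
  simp only [Pi.single_apply, ite_mul, one_mul, zero_mul, Finset.sum_ite_eq', mul_ite, mul_one,
    mul_zero, Finset.mem_univ, if_true, tiltHess, and_self] at h
  have h1 : ∑ b, (tiltCov ν X b i b i / 2 + tiltScore ν X b i ^ 2 / 4) ≤ (n : ℝ) / 2 := by
    have h2 : ∑ b : Fin n, ((tiltCov ν X b i b i - 1) / 2 +
        tiltScore ν X b i * tiltScore ν X b i / 4) =
        ∑ b, (tiltCov ν X b i b i / 2 + tiltScore ν X b i ^ 2 / 4) - n / 2 := by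
      rw [show (n : ℝ) / 2 = ∑ _b : Fin n, (1 / 2 : ℝ) by simp [div_eq_mul_inv],
        ← Finset.sum_sub_distrib]
      exact Finset.sum_congr rfl fun b _ => by ring
    linarith
  have h3 := Finset.single_le_sum (s := Finset.univ)
    (f := fun b => tiltCov ν X b i b i / 2 + tiltScore ν X b i ^ 2 / 4)
    (fun b _ => by have := tiltCov_self_nonneg (ν := ν) X b i; positivity) (Finset.mem_univ a)
  have h4 := tiltCov_self_nonneg (ν := ν) X a i
  have h5 := sq_nonneg (tiltScore ν X a i)
  constructor <;> linarith

theorem continuous_tiltScore [NeZero ν]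
    (hν : ∀ X, Integrable (fun M => Real.exp (frobInner X M)) ν) (a : Fin n) (i : Fin p) :
    Continuous fun X => tiltScore ν X a i :=
  continuous_iff_continuousAt.2 fun X => (hasFDerivAt_tiltScore hν a i X).continuousAt

theorem continuous_tiltHess [NeZero ν]
    (hν : ∀ X, Integrable (fun M => Real.exp (frobInner X M)) ν) (a : Fin n) (i : Fin p)
    (b : Fin n) (j : Fin p) : Continuous fun X => tiltHess ν X a i b j := by
  have h1 : ∀ a i, Continuous fun X => tiltMean ν X a i := fun a i =>
    continuous_iff_continuousAt.2 fun X => (hasFDerivAt_tiltMean hν a i X).continuousAt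
  simp only [tiltHess, tiltCov_eq hν]
  refine Continuous.sub (Continuous.sub (Continuous.div ?_ ?_ fun X =>
    (laplaceTransform_pos hν X).ne') ((h1 a i).mul (h1 b j))) continuous_const
  · exact (contDiff_laplaceMoment hν 0 ((expBounded_entry a i).mul_entry b j)).continuous
  · exact (contDiff_laplaceTransform hν).continuous

theorem integrable_tiltHess [NeZero ν]
    (hν : ∀ X, Integrable (fun M => Real.exp (frobInner X M)) ν)
    (hH : ∀ (X : RealMat n p) (c : Fin p → ℝ), ∑ a, ∑ i, ∑ j, c i * c j *
      (tiltHess ν X a i a j / 2 + tiltScore ν X a i * tiltScore ν X a j / 4) ≤ 0)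
    (M : RealMat n p) (a : Fin n) (i : Fin p) (b : Fin n) (j : Fin p) :
    Integrable (fun X => tiltHess ν X a i b j) (matrixNormal M) := by
  refine Integrable.of_bound (continuous_tiltHess hν a i b j).aestronglyMeasurable (n + 1)
    (Filter.Eventually.of_forall fun X => ?_)
  rw [Real.norm_eq_abs, tiltHess]
  have h1 := abs_tiltCov_le hν X a i b j
  have h2 := (tilt_bounds hH X a i).1
  have h3 := (tilt_bounds hH X b j).1
  have h4 := abs_le.1 h1
  rw [abs_le]
  split_ifs <;> constructor <;> linarith

theorem memLp_tiltScore [NeZero ν]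
    (hν : ∀ X, Integrable (fun M => Real.exp (frobInner X M)) ν)
    (hH : ∀ (X : RealMat n p) (c : Fin p → ℝ), ∑ a, ∑ i, ∑ j, c i * c j *
      (tiltHess ν X a i a j / 2 + tiltScore ν X a i * tiltScore ν X a j / 4) ≤ 0)
    (M : RealMat n p) (a : Fin n) (i : Fin p) :
    MemLp (fun X => tiltScore ν X a i) 2 (matrixNormal M) := by
  refine MemLp.of_bound (continuous_tiltScore hν a i).aestronglyMeasurable (√(2 * n))
    (Filter.Eventually.of_forall fun X => ?_)
  rw [Real.norm_eq_abs]
  exact Real.abs_le_sqrt (tilt_bounds hH X a i).2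

theorem integral_risk_entry [NeZero ν]
    (hν : ∀ X, Integrable (fun M => Real.exp (frobInner X M)) ν)
    (hH : ∀ (X : RealMat n p) (c : Fin p → ℝ), ∑ a, ∑ i, ∑ j, c i * c j *
      (tiltHess ν X a i a j / 2 + tiltScore ν X a i * tiltScore ν X a j / 4) ≤ 0)
    (M : RealMat n p) (a : Fin n) (i j : Fin p) :
    Integrable (fun X => (tiltMean ν X a i - M a i) * (tiltMean ν X a j - M a j))
      (matrixNormal M) ∧
    Integrable (fun X => tiltHess ν X a i a j / 2 +
      tiltScore ν X a i * tiltScore ν X a j / 4) (matrixNormal M) ∧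
    ∫ X, (tiltMean ν X a i - M a i) * (tiltMean ν X a j - M a j) ∂(matrixNormal M) =
      (if i = j then 1 else 0) + 4 * ∫ X, (tiltHess ν X a i a j / 2 +
        tiltScore ν X a i * tiltScore ν X a j / 4) ∂(matrixNormal M) := by
  have ly := fun i => memLp_sub_matrixNormal M a i
  have lg := fun i => memLp_tiltScore hν hH M a i
  have lm : ∀ i, MemLp (fun X => tiltMean ν X a i - M a i) 2 (matrixNormal M) := fun i => by
    refine ((ly i).add (lg i)).congr_norm ?_ (Filter.Eventually.of_forall fun X => ?_)
    · exact ((continuous_iff_continuousAt.2 fun X =>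
        (hasFDerivAt_tiltMean hν a i X).continuousAt).sub continuous_const).aestronglyMeasurable
    · simp [tiltScore]
  -- With `y = X - M` the error of the posterior mean is `y + g`. Stein's identity turns the first
  -- term into `Cov = H + δ_{ij}` and the second into `H`; the total is `δ_{ij} + 2H + g g = δ_{ij}
  -- + 4(H/2 + g g/4)`.
  have e0 : ∀ X : RealMat n p, (tiltMean ν X a i - M a i) * (tiltMean ν X a j - M a j) =
      (X a i - M a i) * (tiltMean ν X a j - M a j) + (X a j - M a j) * tiltScore ν X a i +
        tiltScore ν X a i * tiltScore ν X a j := fun X => by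
    simp only [tiltScore]; ring
  have i1 : Integrable (fun X => (X a i - M a i) * (tiltMean ν X a j - M a j))
    (matrixNormal M) := (ly i).integrable_mul (lm j)
  have i2 : Integrable (fun X => (X a j - M a j) * tiltScore ν X a i) (matrixNormal M) :=
    (ly j).integrable_mul (lg i)
  have i3 : Integrable (fun X => tiltScore ν X a i * tiltScore ν X a j) (matrixNormal M) :=
    (lg i).integrable_mul (lg j)
  have iH := integrable_tiltHess hν hH M a i a j
  have hcov : ∀ X : RealMat n p, tiltCov ν X a j a i =
      tiltHess ν X a i a j + if i = j then 1 else 0 := fun X => by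
    simp [tiltHess, tiltCov_comm X a j a i]
  have s1 : ∫ X, (X a i - M a i) * (tiltMean ν X a j - M a j) ∂(matrixNormal M) =
      ∫ X, tiltCov ν X a j a i ∂(matrixNormal M) :=
    integral_sub_mul_eq_integral_deriv M a i
      (h' := fun X b k => tiltCov ν X a j b k)
      (fun X => (hasFDerivAt_tiltMean hν a j X).sub_const _)
      ((lm j).integrable (by norm_num))
      (by simp only [hcov]; exact iH.add (integrable_const _)) i1
  have s2 : ∫ X, (X a j - M a j) * tiltScore ν X a i ∂(matrixNormal M) =
      ∫ X, tiltHess ν X a i a j ∂(matrixNormal M) :=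
    integral_sub_mul_eq_integral_deriv M a j (h' := fun X b k => tiltHess ν X a i b k)
      (fun X => hasFDerivAt_tiltScore hν a i X) ((lg i).integrable (by norm_num)) iH i2
  simp only [e0]
  refine ⟨(i1.add i2).add i3, (iH.div_const 2).add (i3.div_const 4), ?_⟩
  have i12 : Integrable (fun X => (X a i - M a i) * (tiltMean ν X a j - M a j) +
      (X a j - M a j) * tiltScore ν X a i) (matrixNormal M) := i1.add i2
  rw [integral_add i12 i3, integral_add i1 i2, s1, s2,
    integral_add (iH.div_const 2) (i3.div_const 4), integral_div, integral_div]
  simp only [hcov]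
  rw [integral_add iH (integrable_const _)]
  simp
  ring

end

/-! ### The risk matrix and its Löwner bound -/

section
variable {n p : ℕ} {ν : Measure (RealMat n p)}

theorem dotProduct_mulVec_eq_sum (c : Fin p → ℝ) (A : Matrix (Fin p) (Fin p) ℝ) :
    c ⬝ᵥ A *ᵥ c = ∑ i, ∑ j, c i * c j * A i j := by
  simp only [dotProduct, Matrix.mulVec, Finset.mul_sum]
  exact Finset.sum_congr rfl fun i _ => Finset.sum_congr rfl fun j _ => by ring

theorem matrixLaplacian_sqrtMixture_div [NeZero ν]
    (hν : ∀ X, Integrable (fun M => Real.exp (frobInner X M)) ν) (X : RealMat n p)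
    (i j : Fin p) :
    matrixLaplacian (sqrtMixture ν) X i j / sqrtMixture ν X =
      ∑ a, (tiltHess ν X a i a j / 2 + tiltScore ν X a i * tiltScore ν X a j / 4) := by
  have h : sqrtMixture ν X ≠ 0 := (Real.exp_pos _).ne'
  rw [matrixLaplacian_sqrtMixture hν, mul_div_cancel_left₀ _ h]

theorem risk_tiltMean [NeZero ν]
    (hν : ∀ X, Integrable (fun M => Real.exp (frobInner X M)) ν)
    (hH : ∀ (X : RealMat n p) (c : Fin p → ℝ), ∑ a, ∑ i, ∑ j, c i * c j *
      (tiltHess ν X a i a j / 2 + tiltScore ν X a i * tiltScore ν X a j / 4) ≤ 0)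
    (M : RealMat n p) :
    (∀ i j, Integrable (fun X => quadLoss M (tiltMean ν X) i j) (matrixNormal M)) ∧
    (∀ i j, Integrable (fun X => matrixLaplacian (sqrtMixture ν) X i j / sqrtMixture ν X)
      (matrixNormal M)) ∧
    riskMatrix (tiltMean ν) M = (n : ℝ) • (1 : Matrix (Fin p) (Fin p) ℝ) +
      (4 : ℝ) • Matrix.of (fun i j =>
        ∫ X, matrixLaplacian (sqrtMixture ν) X i j / sqrtMixture ν X ∂(matrixNormal M)) := by
  have h := integral_risk_entry hν hH M
  simp only [quadLoss_apply, matrixLaplacian_sqrtMixture_div hν]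
  refine ⟨fun i j => integrable_finsetSum _ fun a _ => (h a i j).1,
    fun i j => integrable_finsetSum _ fun a _ => (h a i j).2.1, ?_⟩
  ext i j
  simp only [riskMatrix, Matrix.of_apply, quadLoss_apply, Matrix.add_apply, Matrix.smul_apply,
    smul_eq_mul]
  rw [integral_finsetSum _ fun a _ => (h a i j).1, integral_finsetSum _ fun a _ => (h a i j).2.1,
    Finset.sum_congr rfl fun a _ => (h a i j).2.2, Finset.sum_add_distrib, Finset.mul_sum]
  simp [Matrix.one_apply]

theorem quadratic_laplacian_integral_nonpos [NeZero ν]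
    (hν : ∀ X, Integrable (fun M => Real.exp (frobInner X M)) ν)
    (hH : ∀ (X : RealMat n p) (c : Fin p → ℝ), ∑ a, ∑ i, ∑ j, c i * c j *
      (tiltHess ν X a i a j / 2 + tiltScore ν X a i * tiltScore ν X a j / 4) ≤ 0)
    (M : RealMat n p) (c : Fin p → ℝ) :
    c ⬝ᵥ Matrix.of (fun i j => ∫ X, matrixLaplacian (sqrtMixture ν) X i j / sqrtMixture ν X
      ∂(matrixNormal M)) *ᵥ c ≤ 0 := by
  have hi := (risk_tiltMean hν hH M).2.1
  have e2 : c ⬝ᵥ Matrix.of (fun i j => ∫ X, matrixLaplacian (sqrtMixture ν) X i j /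
      sqrtMixture ν X ∂(matrixNormal M)) *ᵥ c = ∫ X, ∑ i, ∑ j, c i * c j *
        (matrixLaplacian (sqrtMixture ν) X i j / sqrtMixture ν X) ∂(matrixNormal M) := by
    rw [dotProduct_mulVec_eq_sum, integral_finsetSum _ fun i _ =>
      integrable_finsetSum _ fun j _ => (hi i j).const_mul _]
    refine Finset.sum_congr rfl fun i _ => ?_
    rw [integral_finsetSum _ fun j _ => (hi i j).const_mul _]
    exact Finset.sum_congr rfl fun j _ => (integral_const_mul _ _).symm
  rw [e2]
  refine integral_nonpos fun X => le_of_eq_of_le ?_ (hH X c)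
  simp only [matrixLaplacian_sqrtMixture_div hν, Finset.mul_sum]
  exact (Finset.sum_comm.trans (Finset.sum_congr rfl fun i _ => Finset.sum_comm)).symm

theorem riskForm_tiltMean_le [NeZero ν]
    (hν : ∀ X, Integrable (fun M => Real.exp (frobInner X M)) ν)
    (hH : ∀ (X : RealMat n p) (c : Fin p → ℝ), ∑ a, ∑ i, ∑ j, c i * c j *
      (tiltHess ν X a i a j / 2 + tiltScore ν X a i * tiltScore ν X a j / 4) ≤ 0)
    (c : Fin p → ℝ) (M : RealMat n p) :
    riskForm (tiltMean ν) c M ≤ ENNReal.ofReal (n * ∑ i, c i ^ 2) := by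
  obtain ⟨h1, -, h3⟩ := risk_tiltMean hν hH M
  have h4 := quadratic_laplacian_integral_nonpos hν hH M c
  have hi : Integrable (fun X => c ⬝ᵥ quadLoss M (tiltMean ν X) *ᵥ c) (matrixNormal M) := by
    simp only [dotProduct_mulVec_eq_sum]
    exact integrable_finsetSum _ fun i _ => integrable_finsetSum _ fun j _ => (h1 i j).const_mul _
  have e : ∫ X, c ⬝ᵥ quadLoss M (tiltMean ν X) *ᵥ c ∂(matrixNormal M) =
      c ⬝ᵥ riskMatrix (tiltMean ν) M *ᵥ c := by
    simp only [dotProduct_mulVec_eq_sum, riskMatrix, Matrix.of_apply]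
    rw [integral_finsetSum _ fun i _ => integrable_finsetSum _ fun j _ => (h1 i j).const_mul _]
    refine Finset.sum_congr rfl fun i _ => ?_
    rw [integral_finsetSum _ fun j _ => (h1 i j).const_mul _]
    exact Finset.sum_congr rfl fun j _ => integral_const_mul _ _
  unfold riskForm quadLossForm
  rw [← ofReal_integral_eq_lintegral_ofReal hi, e, h3]
  · refine ENNReal.ofReal_le_ofReal ?_
    rw [Matrix.add_mulVec, dotProduct_add, Matrix.smul_mulVec, Matrix.smul_mulVec,
      dotProduct_smul, dotProduct_smul, Matrix.one_mulVec, smul_eq_mul, smul_eq_mul]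
    have : c ⬝ᵥ c = ∑ i, c i ^ 2 := by simp [dotProduct, sq]
    rw [this]
    linarith
  · refine Filter.Eventually.of_forall fun X => ?_
    simp only [Pi.zero_apply, dotProduct_quadLoss]
    positivity

theorem posSemidef_sub_riskMatrix [NeZero ν]
    (hν : ∀ X, Integrable (fun M => Real.exp (frobInner X M)) ν)
    (hH : ∀ (X : RealMat n p) (c : Fin p → ℝ), ∑ a, ∑ i, ∑ j, c i * c j *
      (tiltHess ν X a i a j / 2 + tiltScore ν X a i * tiltScore ν X a j / 4) ≤ 0)
    (M : RealMat n p) :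
    ((n : ℝ) • (1 : Matrix (Fin p) (Fin p) ℝ) - riskMatrix (tiltMean ν) M).PosSemidef := by
  refine Matrix.PosSemidef.of_dotProduct_mulVec_nonneg ?_ fun c => ?_
  · have h : (riskMatrix (tiltMean ν) M).IsHermitian := by
      ext i j
      simp only [Matrix.conjTranspose_apply, riskMatrix, Matrix.of_apply, star_trivial,
        quadLoss_apply]
      exact integral_congr_ae (Filter.Eventually.of_forall fun X =>
        Finset.sum_congr rfl fun a _ => mul_comm _ _)
    exact (Matrix.isHermitian_one.smul (IsSelfAdjoint.all _)).sub h
  · rw [(risk_tiltMean hν hH M).2.2, sub_add_cancel_left, star_trivial, Matrix.neg_mulVec,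
      dotProduct_neg, Matrix.smul_mulVec, dotProduct_smul, smul_eq_mul]
    linarith [quadratic_laplacian_integral_nonpos hν hH M c]

/-! ### Generalized Bayes estimators -/

theorem lintegral_quadLossForm_expTilt [NeZero ν]
    (hν : ∀ X, Integrable (fun M => Real.exp (frobInner X M)) ν) (X D : RealMat n p)
    (c : Fin p → ℝ) :
    ∫⁻ M, quadLossForm c M D ∂(expTilt ν X) =
      ENNReal.ofReal (∑ a, Var[fun M : RealMat n p => ∑ i, M a i * c i; expTilt ν X] +
        ∑ a, (∑ i, D a i * c i - ∑ i, tiltMean ν X a i * c i) ^ 2) := by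
  have := isProbabilityMeasure_expTilt hν X
  unfold quadLossForm
  simp_rw [dotProduct_quadLoss]
  have hm := fun a i => memLp_entry_expTilt hν X a i
  rw [lintegral_ofReal_sum_sq _ (fun a (M : RealMat n p) => ∑ i, M a i * c i)
    (fun a => memLp_finsetSum _ fun i _ => (hm a i).mul_const _) fun a => ∑ i, D a i * c i]
  congr 2
  refine Finset.sum_congr rfl fun a _ => ?_
  rw [integral_finsetSum _ fun i _ => ((hm a i).integrable (by norm_num)).mul_const _]
  simp only [integral_mul_const, tiltMean]

theorem isGeneralizedBayes_iff [NeZero ν]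
    (hν : ∀ X, Integrable (fun M => Real.exp (frobInner X M)) ν) {π : RealMat n p → ℝ≥0∞}
    (hpost : ∀ X, posterior π X = expTilt ν X) (δ : RealMat n p → RealMat n p) :
    IsGeneralizedBayes π δ ↔ δ = tiltMean ν := by
  have hV : ∀ (X : RealMat n p) (c : Fin p → ℝ),
      0 ≤ ∑ a, Var[fun M : RealMat n p => ∑ i, M a i * c i; expTilt ν X] := fun X c =>
    Finset.sum_nonneg fun a _ => variance_nonneg _ _
  simp only [IsGeneralizedBayes, hpost, lintegral_quadLossForm_expTilt hν]
  constructor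
  · intro h
    funext X a i
    -- Only the bias depends on the decision and it vanishes at the mean. Testing against coordinate
    -- vectors therefore forces every column of `δ X` to agree with the mean.
    have h1 := h X (tiltMean ν X) (Pi.single i 1)
    simp only [sub_self, ne_eq, OfNat.ofNat_ne_zero, not_false_eq_true, zero_pow,
      Finset.sum_const_zero, add_zero] at h1
    rw [ENNReal.ofReal_le_ofReal_iff (hV X _), add_le_iff_nonpos_right] at h1
    simp only [Pi.single_apply, mul_ite, mul_one, mul_zero, Finset.sum_ite_eq', Finset.mem_univ,
      if_true] at h1
    have h2 := Finset.single_le_sum (s := Finset.univ)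
      (f := fun a => (δ X a i - tiltMean ν X a i) ^ 2) (fun a _ => sq_nonneg _)
      (Finset.mem_univ a)
    have h3 : (δ X a i - tiltMean ν X a i) ^ 2 = 0 := le_antisymm (h2.trans h1) (sq_nonneg _)
    exact sub_eq_zero.1 (pow_eq_zero_iff two_ne_zero |>.1 h3)
  · rintro rfl X D c
    refine ENNReal.ofReal_le_ofReal ?_
    simp only [sub_self, ne_eq, OfNat.ofNat_ne_zero, not_false_eq_true, zero_pow,
      Finset.sum_const_zero, add_zero]
    exact le_add_of_nonneg_right (Finset.sum_nonneg fun a _ => sq_nonneg _)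

/-! ### Translation to the marginal -/

variable {π : RealMat n p → ℝ≥0∞}

theorem marginal_eq_ofReal_exp_logMixture (hπ : Measurable π) [NeZero (priorBase π)]
    (hν : ∀ X, Integrable (fun M => Real.exp (frobInner X M)) (priorBase π)) (X : RealMat n p) :
    marginal π X = ENNReal.ofReal (Real.exp (logMixture (priorBase π) X)) := by
  rw [marginal_eq hπ, ← ofReal_integral_eq_lintegral_ofReal (hν X)
    (Filter.Eventually.of_forall fun M => (Real.exp_pos _).le), ← laplaceTransform_eq,
    ← ENNReal.ofReal_mul (Real.exp_pos _).le, logMixture, sub_eq_add_neg, Real.exp_add,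
    Real.exp_log (laplaceTransform_pos hν X), mul_comm, neg_div]

theorem sqrtMarginal_eq (hπ : Measurable π) [NeZero (priorBase π)]
    (hν : ∀ X, Integrable (fun M => Real.exp (frobInner X M)) (priorBase π)) :
    sqrtMarginal π = sqrtMixture (priorBase π) := by
  funext X
  rw [sqrtMarginal, marginal_eq_ofReal_exp_logMixture hπ hν,
    ENNReal.toReal_ofReal (Real.exp_pos _).le, sqrtMixture, ← div_eq_mul_one_div, Real.exp_half]

theorem bayesEstimator_eq (hπ : Measurable π) [NeZero (priorBase π)]
    (hν : ∀ X, Integrable (fun M => Real.exp (frobInner X M)) (priorBase π)) :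
    bayesEstimator π = tiltMean (priorBase π) := by
  have h : (fun Y => Real.log (marginal π Y).toReal) = logMixture (priorBase π) := by
    funext Y
    rw [marginal_eq_ofReal_exp_logMixture hπ hν, ENNReal.toReal_ofReal (Real.exp_pos _).le,
      Real.log_exp]
  funext X a i
  simp only [bayesEstimator, h, matrixGradient, Pi.add_apply]
  rw [partialDeriv_of_hasFDerivAt (hasFDerivAt_logMixture hν X),
    sum_smul_entryCLM_single (tiltScore (priorBase π) X), tiltScore]
  ring

/-- The factor `e^{-‖X‖²/2}` occurs in both the likelihood and the marginal and cancels, leaving the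
normalization by the Laplace transform. -/
theorem posterior_eq (hπ : Measurable π) [NeZero (priorBase π)]
    (hν : ∀ X, Integrable (fun M => Real.exp (frobInner X M)) (priorBase π)) (X : RealMat n p) :
    posterior π X = expTilt (priorBase π) X := by
  unfold _root_.posterior
  rw [withDensity_likelihood_mul hπ, ← withDensity_smul _
    (Measurable.ennreal_ofReal (Continuous.measurable (by fun_prop))), expTilt, Measure.tilted]
  congr 1
  funext M
  rw [Pi.smul_apply, smul_eq_mul, marginal_eq_ofReal_exp_logMixture hπ hν,
    ← ENNReal.ofReal_inv_of_pos (Real.exp_pos _), ← ENNReal.ofReal_mul (by positivity),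
    ← laplaceTransform_eq, logMixture, Real.exp_sub, Real.exp_log (laplaceTransform_pos hν X),
    neg_div, Real.exp_neg]
  congr 1
  have := laplaceTransform_pos hν X
  have := Real.exp_pos (frobInner X X / 2)
  field_simp

/-- Once finiteness has made `√m_π` a real `C²` function, the ball inequality holds for real
integrals and the second-order argument applies. Dividing by `√m_π > 0` leaves the bound on scores
and covariances. -/
theorem MatrixSuperharmonic.sum_tiltHess_nonpos (hn : 0 < n) (hπ : Measurable π)
    [NeZero (priorBase π)]
    (hν : ∀ X, Integrable (fun M => Real.exp (frobInner X M)) (priorBase π))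
    (hs : MatrixSuperharmonic
      fun X : RealMat n p => (((marginal π X) ^ (1 / 2 : ℝ) : ℝ≥0∞) : EReal))
    (X : RealMat n p) (c : Fin p → ℝ) :
    ∑ a, ∑ i, ∑ j, c i * c j * (tiltHess (priorBase π) X a i a j / 2 +
      tiltScore (priorBase π) X a i * tiltScore (priorBase π) X a j / 4) ≤ 0 := by
  set u := sqrtMixture (priorBase π) with hu
  have hu0 : ∀ Y, 0 < u Y := fun Y => Real.exp_pos _
  have hc := contDiff_sqrtMixture hν
  have hm : ∀ Y, (marginal π Y) ^ (1 / 2 : ℝ) = ENNReal.ofReal (u Y) := fun Y => by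
    rw [marginal_eq_ofReal_exp_logMixture hπ hν,
      ENNReal.ofReal_rpow_of_nonneg (Real.exp_pos _).le (by norm_num), ← Real.exp_mul]
    rfl
  have hR : ∀ R > 0, ∫ v in Metric.ball 0 R, u (rankOneShift X c v) ≤
      volume.real (Metric.ball (0 : EuclideanSpace ℝ (Fin n)) R) * u X := by
    intro R _
    have h1 := hs.setLIntegral_ball_le hn ((measurable_marginal hπ).pow_const _) X c R
    simp only [hm] at h1
    have hi : IntegrableOn (fun v => u (rankOneShift X c v)) (Metric.ball 0 R) :=
      continuous_integrableOn_ball (hc.continuous.comp (continuous_rankOneShift X c)) R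
    rw [← ofReal_integral_eq_lintegral_ofReal hi
      (Filter.Eventually.of_forall fun v => (hu0 _).le),
      ← ofReal_measureReal measure_ball_lt_top.ne,
      ← ENNReal.ofReal_mul measureReal_nonneg] at h1
    exact (ENNReal.ofReal_le_ofReal_iff
      (mul_nonneg measureReal_nonneg (hu0 X).le)).1 h1
  have h2 := sum_fderiv_fderiv_nonpos hc X c hR
  simp only [fderiv_fderiv_sqrtMixture_rowMatrix hν] at h2
  have h3 : u X * ∑ a, ∑ i, ∑ j, c i * c j * (tiltHess (priorBase π) X a i a j / 2 +
      tiltScore (priorBase π) X a i * tiltScore (priorBase π) X a j / 4) ≤ 0 := by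
    refine le_of_eq_of_le ?_ h2
    simp only [Finset.mul_sum]
    exact Finset.sum_congr rfl fun a _ => Finset.sum_congr rfl fun i _ =>
      Finset.sum_congr rfl fun j _ => by ring
  exact nonpos_of_mul_nonpos_right h3 (hu0 X)

end

/-- The hypothesis concerns the extended-valued square root because finiteness of the marginal is a
conclusion; afterwards it coincides with the real function `sqrtMarginal π`. -/
theorem mainTheorem3 {n p : ℕ} (hn : 0 < n) (π : RealMat n p → ℝ≥0∞) (hπ : Measurable π)
    (hπ0 : ¬ π =ᵐ[volume] 0)
    (hsuper : MatrixSuperharmonic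
      fun X : RealMat n p => (((marginal π X) ^ (1 / 2 : ℝ) : ℝ≥0∞) : EReal)) :
    -- the marginal is positive and finite, and its square root is `C²`
    (∀ X, 0 < marginal π X ∧ marginal π X < ∞) ∧
    ContDiff ℝ 2 (sqrtMarginal π) ∧
    -- `X + ∇̃ log m_π(X)` is the unique generalized Bayes estimator
    (∀ δ : RealMat n p → RealMat n p, IsGeneralizedBayes π δ ↔ δ = bayesEstimator π) ∧
    -- it is minimax
    IsMinimax (bayesEstimator π) ∧
    -- its risk is finite, equals `n I_p + 4 E_M[Δ̃ √m_π(X) / √m_π(X)]`, and is `⪯ n I_p`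
    ∀ M : RealMat n p,
      (∀ i j, Integrable (fun X => quadLoss M (bayesEstimator π X) i j) (matrixNormal M)) ∧
      (∀ i j, Integrable (fun X => matrixLaplacian (sqrtMarginal π) X i j / sqrtMarginal π X)
        (matrixNormal M)) ∧
      riskMatrix (bayesEstimator π) M =
        (n : ℝ) • (1 : Matrix (Fin p) (Fin p) ℝ) +
          (4 : ℝ) • Matrix.of (fun i j =>
            ∫ X, matrixLaplacian (sqrtMarginal π) X i j / sqrtMarginal π X ∂(matrixNormal M)) ∧
      ((n : ℝ) • (1 : Matrix (Fin p) (Fin p) ℝ) - riskMatrix (bayesEstimator π) M).PosSemidef := by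
  have hfin := marginal_lt_top hn hπ hsuper
  have hν := fun X => (marginal_lt_top_iff hπ X).1 (hfin X)
  have : NeZero (priorBase π) := ⟨priorBase_ne_zero hπ hπ0⟩
  have hH := hsuper.sum_tiltHess_nonpos hn hπ hν
  rw [bayesEstimator_eq hπ hν, sqrtMarginal_eq hπ hν]
  refine ⟨fun X => ⟨marginal_pos hπ hπ0 X, hfin X⟩, contDiff_sqrtMixture hν,
    isGeneralizedBayes_iff hν (posterior_eq hπ hν),
    isMinimax_of_riskForm_le ?_ (riskForm_tiltMean_le hν hH), fun M => ?_⟩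
  · exact Continuous.measurable (continuous_pi fun a => continuous_pi fun i =>
      continuous_iff_continuousAt.2 fun X => (hasFDerivAt_tiltMean hν a i X).continuousAt)
  · obtain ⟨h1, h2, h3⟩ := risk_tiltMean hν hH M
    exact ⟨h1, h2, h3, posSemidef_sub_riskMatrix hν hH M⟩
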